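/- **Set-up.** For $x,y\in\mathbb R^\times$ put $\langle x,y\rangle=(-1)^{\varepsilon_x\varepsilon_y}e^{4\pi i\log|x|\log|y|}$, where $\varepsilon_x=0$ if $x>0$ and $\varepsilon_x=1$ if $x<0$. An angle is an element $a=(\dot a,\ddot a)$ of the abelian group $\mathbb R\times\mathbb R^\times$ (written additively); put $\varpi=(1,-1)$ and $\bar a=(\dot a,\ddot a^{-1})$. For angles $a,c$ let $$\Psi_{a,c}(\alpha,x)=\langle\alpha,(1-\ddot a x)\ddot c\rangle^{-1}\frac{|\ddot a x|^{\dot c}}{|1-\ddot a x|^{1-\dot a}},\qquad \bar\Psi_{a,c}(\alpha,x)=\overline{\Psi_{\bar a,\bar c}(\alpha,x)},$$ $$h_{a,c}(\alpha,\gamma)=\int_{\mathbb R^\times}\bar\Psi_{a,c}(\alpha^{-1},y^{-1})\,\langle\gamma,y\rangle\,\frac{dy}{|y|},\qquad \bar h_{a,c}(\alpha,\gamma)=\overline{h_{\bar a,\bar c}(\alpha,\gamma)}.$$ A tetrahedron has angles $a,b,c$ at its pairs of opposite edges $(01,23)$, $(02,13)$, $(03,12)$; if its edges carry variables $x_{ij}\in\mathbb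 R^\times$, its weight is $h_{a,c}\big(\tfrac{x_{02}x_{13}}{x_{03}x_{12}},\tfrac{x_{01}x_{23}}{x_{02}x_{13}}\big)$ if it is positively oriented, and the same with $\bar h$ if it is negatively oriented. Consider the ideal triangulation of the complement of the $4_1$ knot with two edges $0,1$, a positive tetrahedron $T_0$ and a negative tetrahedron $T_1$, in which the edges $01,02,03,12,13,23$ are identified with $0,1,0,1,1,0$ for $T_0$ and with $1,0,1,0,0,1$ for $T_1$. An angle structure $\theta$ consists of angles $a_j,b_j,c_j$ ($j=0,1$) with $a_j+b_j+c_j=\varpi$, with $\dot a_j,\dot b_j,\dot c_j>0$, and such that the sum of the angles around each of the two edges is $2\varpi$. Its longitude and meridian holonomies are $\lambda=2a_0+c_0-\varpi$ and $\mu=a_0-a_1$. The $\hat{\mathbb R}$-edge invariant of $4_1$ is the state-integral $$\mathcal E_{\hat{\mathbb R},4_1}=\int_{\mathbb R^\times}h_{a_0,c_0}(x,x^{-2})\,\bar h_{a_1,c_1}(x^{-1},x^{2})\,\frac{dx}{|x|},$$ understood as the improper integral $\lim_{r\to0^+,\,R\to\infty}\int_{r<|x|<R}$. Let $\mathrm B(z,w)=\int_0^1t^{z-1}(1-t)^{w-1}\,dt$.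 **Theorem.** (1) For every angle structure $\theta$ the state-integral converges, and its value depends only on $\lambda$ and $\mu$; denote it by $\mathcal E_{\hat{\mathbb R},4_1}(\lambda,\mu)$. For every real $\epsilon$ with $$\epsilon>0,\quad \epsilon>\dot\lambda,\quad \epsilon>-\dot\mu,\quad \epsilon>\dot\lambda-\dot\mu,\quad \epsilon<\tfrac12+\tfrac{\dot\lambda}2,\quad \epsilon<\tfrac12+\tfrac{\dot\lambda}2-\dot\mu$$ (for instance $\epsilon=\dot a_1$) one has $$\mathcal E_{\hat{\mathbb R},4_1}(\lambda,\mu)=\frac1{2\pi i}\int_{\epsilon-i\infty}^{\epsilon+i\infty}\frac{\mathrm B(z,z-\dot\lambda)\,\mathrm B(z+\dot\mu,z+\dot\mu-\dot\lambda)}{\cos(\pi(z-\frac{\dot\lambda}2))\cos(\pi(z+\dot\mu-\frac{\dot\lambda}2))}\Big(\cos\frac{\pi\dot\lambda}2\Big)^2dz ,$$ and also, with $y=\sqrt{(1-x)(1-x+4x^2)}$, $$\mathcal E_{\hat{\mathbb R},4_1}(\lambda,\mu)=\int_{-\infty}^1\frac{|1-x|^{\dot\mu}\big(|y+x-1|^{\dot\lambda}+|-y+x-1|^{\dot\lambda}\big)}{|x|^{2\dot\mu+\dot\lambda}\,2^{\dot\lambda}}\,\frac{dx}{y},$$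 where both integrals converge absolutely. (2) For every $\epsilon$ with $0<\epsilon<\frac12$, $$\frac1{2\pi i}\int_{\epsilon-i\infty}^{\epsilon+i\infty}\frac{\mathrm B(z,z)^2}{\cos(\pi z)^2}\,dz=2\int_{-\infty}^1\frac{dx}{\sqrt{(1-x)(1-x+4x^2)}}=5.60241216\dots,$$ where both integrals converge absolutely and the dots mean that the common value lies in $[5.60241216,\,5.60241217)$. -/

import Mathlib

open scoped Topology

namespace EdgeInvariant

noncomputable section

/-- The angle group `ℝ × ℝˣ`, written additively: the first components are added, the second
components (in `Additive ℝˣ`) are multiplied. -/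
abbrev Angle : Type := ℝ × Additive ℝˣ

/-- The real component `ȧ` of an angle. -/
def dot (a : Angle) : ℝ := a.1

/-- The component `ä ∈ ℝˣ` of an angle, as a nonzero real number. -/
def ddot (a : Angle) : ℝ := ((Additive.toMul a.2 : ℝˣ) : ℝ)

/-- The angle `ϖ = (1, -1)`. -/
def varpi : Angle := (1, Additive.ofMul (-1 : ℝˣ))

/-- The conjugate angle `ā = (ȧ, ä⁻¹)`. -/
def angleConj (a : Angle) : Angle := (a.1, -a.2)

/-- `ε_x = 0` for `x > 0` and `ε_x = 1` for `x < 0`. -/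
def signBit (x : ℝ) : ℕ := if x < 0 then 1 else 0

/-- The pairing `⟨x, y⟩ = (-1)^{ε_x ε_y} e^{4 π i log|x| log|y|}` identifying `ℝˣ` with its
Pontryagin dual. It is meant for nonzero `x` and `y` only. -/
def pairing (x y : ℝ) : ℂ :=
  (-1) ^ (signBit x * signBit y) *
    Complex.exp (4 * Real.pi * Complex.I * Real.log |x| * Real.log |y|)

/-- The angled quantum dilogarithm over `ℝ`,
`Ψ_{a,c}(α, x) = α((1 - ä x) c̈)⁻¹ |ä x|^ċ / |1 - ä x|^{1 - ȧ}`, for `x ≠ 1 / ä`. -/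
def Psi (a c : Angle) (α x : ℝ) : ℂ :=
  (pairing α ((1 - ddot a * x) * ddot c))⁻¹ *
    ((|ddot a * x| ^ dot c / |1 - ddot a * x| ^ (1 - dot a) : ℝ) : ℂ)

/-- `Ψ̄_{a,c}(α, x)` is the complex conjugate of `Ψ_{ā,c̄}(α, x)`. -/
def PsiBar (a c : Angle) (α x : ℝ) : ℂ :=
  (starRingEnd ℂ) (Psi (angleConj a) (angleConj c) α x)

/-- The Weil transform `h_{a,c}(α, γ) = ∫ Ψ̄_{a,c}(α⁻¹, y⁻¹) γ(y) dy` of the quantum dilogarithm,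
an integral over `ℝˣ` with respect to its Haar measure `dy / |y|`. -/
def h (a c : Angle) (α γ : ℝ) : ℂ :=
  ∫ y : ℝ, PsiBar a c α⁻¹ y⁻¹ * pairing γ y * ((|y|⁻¹ : ℝ) : ℂ)

/-- `h̄_{a,c}(α, γ)` is the complex conjugate of `h_{ā,c̄}(α, γ)`. -/
def hBar (a c : Angle) (α γ : ℝ) : ℂ :=
  (starRingEnd ℂ) (h (angleConj a) (angleConj c) α γ)

/-- The Boltzmann weight of a tetrahedron with state variable `x q k` at its edges. The index
`q : Fin 3` is a pair of opposite edges, namely `(01, 23)`, `(02, 13)` and `(03, 12)` for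
`q = 0, 1, 2`, and `k : Fin 2` is an edge of the pair, in this order. The angles `a` and `c` belong
to the pairs `0` and `2`. A negatively oriented tetrahedron gets the conjugate weight. -/
def tetWeight (positive : Bool) (a c : Angle) (x : Fin 3 → Fin 2 → ℝ) : ℂ :=
  if positive then
    h a c (x 1 0 * x 1 1 / (x 2 0 * x 2 1)) (x 0 0 * x 0 1 / (x 1 0 * x 1 1))
  else
    hBar a c (x 1 0 * x 1 1 / (x 2 0 * x 2 1)) (x 0 0 * x 0 1 / (x 1 0 * x 1 1))

/-- The ideal triangulation of the complement of the `4_1` knot with two tetrahedra and two edges: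
`edge41 j q k` is the edge of the triangulation to which the edge `(q, k)` of the tetrahedron `j` is
glued. In terms of the edges `01, 02, 03, 12, 13, 23`, this is `0, 1, 0, 1, 1, 0` for the tetrahedron
`0` and `1, 0, 1, 0, 0, 1` for the tetrahedron `1`. -/
def edge41 : Fin 2 → Fin 3 → Fin 2 → Fin 2 :=
  ![![![0, 0], ![1, 1], ![0, 1]], ![![1, 1], ![0, 0], ![1, 0]]]

/-- In the triangulation of `4_1`, the tetrahedron `0` is positive and `1` is negative. -/
def positive41 : Fin 2 → Bool := ![true, false]

/-- A strictly positive balanced angle structure on the triangulation of `4_1`: `angle j q` is the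
angle at the pair `q` of opposite edges of the tetrahedron `j`; so the angles `a`, `b`, `c` of the
tetrahedron `j` are `angle j 0`, `angle j 1`, `angle j 2`. -/
structure AngleStructure41 where
  angle : Fin 2 → Fin 3 → Angle
  sum_eq : ∀ j, angle j 0 + angle j 1 + angle j 2 = varpi
  pos : ∀ j q, 0 < dot (angle j q)
  balanced : ∀ e : Fin 2,
    (∑ j, ∑ q, ∑ k, if edge41 j q k = e then angle j q else 0) = 2 • varpi

/-- The angle holonomy `λ = 2 a₀ + c₀ - ϖ` of (half of) the longitude. -/
def AngleStructure41.longitude (θ : AngleStructure41) : Angle :=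
  2 • θ.angle 0 0 + θ.angle 0 2 - varpi

/-- The angle holonomy `μ = a₀ - a₁` of the meridian. -/
def AngleStructure41.meridian (θ : AngleStructure41) : Angle :=
  θ.angle 0 0 - θ.angle 1 0

/-- The product of the Boltzmann weights of the two tetrahedra, as a function of the state
variables at the two edges. -/
def stateProduct41 (θ : AngleStructure41) (x : Fin 2 → ℝ) : ℂ :=
  ∏ j, tetWeight (positive41 j) (θ.angle j 0) (θ.angle j 2) (fun q k => x (edge41 j q k))

/-- The edge state-integral of `4_1` over `{t ∈ ℝˣ : r < |t| < R}`, with respect to the Haar measure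
`dt / |t|`. The state variable at one of the two edges is fixed to be `1`. -/
def truncatedStateIntegral41 (θ : AngleStructure41) (r R : ℝ) : ℂ :=
  ∫ t in {t : ℝ | r < |t| ∧ |t| < R}, stateProduct41 θ ![1, t] * ((|t|⁻¹ : ℝ) : ℂ)

/-- `E` is the value of the edge state-integral of `4_1` over `ℝˣ`. The integral is not absolutely
convergent; it is an improper integral at both ends `0` and `∞` of `ℝˣ`, independently. -/
def HasStateIntegral41 (θ : AngleStructure41) (E : ℂ) : Prop :=
  Filter.Tendsto (fun p : ℝ × ℝ => truncatedStateIntegral41 θ p.1 p.2)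
    (𝓝[>] (0 : ℝ) ×ˢ Filter.atTop) (𝓝 E)

/-- The integrand of the Mellin–Barnes integral of `4_1`, for `l = λ̇` and `m = μ̇`. -/
def mellinBarnesIntegrand (l m : ℝ) (z : ℂ) : ℂ :=
  Complex.betaIntegral z (z - l) * Complex.betaIntegral (z + m) (z + m - l) /
    (Complex.cos (Real.pi * (z - l / 2)) * Complex.cos (Real.pi * (z + m - l / 2))) *
    Complex.cos (Real.pi * (l / 2)) ^ 2

/-- The integral of `f` over the vertical line `Re z = s`, oriented upwards. -/
def verticalIntegral (f : ℂ → ℂ) (s : ℝ) : ℂ :=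
  ∫ t : ℝ, f (s + t * Complex.I) * Complex.I

/-- Absolute convergence of the integral of `f` over the vertical line `Re z = s`. -/
def VerticalIntegrable (f : ℂ → ℂ) (s : ℝ) : Prop :=
  MeasureTheory.Integrable (fun t : ℝ => f (s + t * Complex.I))

/-- The function `y = √((1 - x) (1 - x + 4 x²))`. -/
def curveY (x : ℝ) : ℝ := Real.sqrt ((1 - x) * (1 - x + 4 * x ^ 2))

/-- The integrand of the period integral of `4_1`, for `l = λ̇` and `m = μ̇`. -/
def periodIntegrand (l m x : ℝ) : ℝ :=
  |1 - x| ^ m * (|curveY x + x - 1| ^ l + |-curveY x + x - 1| ^ l) /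
    (|x| ^ (2 * m + l) * 2 ^ l) / curveY x

/-- The real parts `s` of the vertical lines in the strip to the right of the poles of the beta
functions and to the left of the next poles of the two factors `1 / cos`. -/
def contourStrip (l m : ℝ) : Set ℝ :=
  {s | 0 < s ∧ 0 < s - l ∧ 0 < s + m ∧ 0 < s + m - l ∧
    s - l / 2 < 1 / 2 ∧ s + m - l / 2 < 1 / 2}

end

end EdgeInvariant

open scoped Topology

namespace EdgeInvariant

open MeasureTheory Filter Set
open scoped FourierTransform Convolution

/-! Write l, m for the real parts of λ, μ. Balancing makes 2a + c equal for both tetrahedra in the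
full angle group, so the unitary prefactors of the two weights cancel and each weight becomes W(t) =
∫ ⟨t, u(u-1)⟩⁻¹ |u|^(a-l-1) |u-1|^(a-1) du, where a now denotes the real part of a₀ or a₁
(`stateProduct41_eq`). With ξ = 2 log|t| this is a Fourier transform in τ = log|u(u-1)|. The part
u(u-1) > 0 has the smooth density `logDensity`. The part 0 < u < 1 has a density supported on τ ≤
-log 4, and only its contribution changes sign with t. Thus the weights are P ± N and Q ± K
(`reducedWeight_eq`), and averaging over the sign leaves PQ + NK.

The integral of NK is formally the value at 0 of a convolution supported away from 0; its
truncations tend to 0 by Riemann–Lebesgue (`tendsto_integral_fourier_mul_fourier`). The product PQ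
is integrable, and Fourier inversion turns its integral into ∫ f(τ) g(-τ) dτ for the two densities,
which depends only on l and m: this is `knotIntegral`.

The Mellin–Barnes integral is the same Parseval identity for the exponents ε and ε + m, since the
transform of `logDensity` is a Beta function divided by a cosine (`fourier_logDensity`). The period
arises from x = 1/u, with u running over both roots of u(u-1) = e^τ (`integral_periodIntegrand`).
For l = m = 0 it is a complete elliptic integral, enclosed by the arithmetic-geometric mean
(`agmIntegral_one_quarter_mem`). -/

/-! ### Fourier transforms of products and of pushforwards -/

theorem continuous_fourier_of_integrable {f : ℝ → ℂ} (hf : Integrable f) : Continuous (𝓕 f) :=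
  VectorFourier.fourierIntegral_continuous Real.continuous_fourierChar
    (by exact continuous_inner) hf

theorem norm_fourier_le_integral_norm (f : ℝ → ℂ) (ξ : ℝ) : ‖𝓕 f ξ‖ ≤ ∫ x, ‖f x‖ :=
  VectorFourier.norm_fourierIntegral_le_integral_norm _ _ _ f ξ

/-- The Fourier transform of an integrable function with integrable derivative decays like the
inverse of the frequency. -/
theorem exists_norm_fourier_mul_le {f : ℝ → ℂ} (hf : Integrable f) (hd : Differentiable ℝ f)
    (hf' : Integrable (deriv f)) : ∃ C, ∀ ξ : ℝ, ‖𝓕 f ξ‖ * (1 + |ξ|) ≤ C := by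
  refine ⟨(∫ x, ‖f x‖) + ∫ x, ‖deriv f x‖, fun ξ => ?_⟩
  have h1 := norm_fourier_le_integral_norm f ξ
  have h2 := norm_fourier_le_integral_norm (deriv f) ξ
  rw [Real.fourier_deriv hf hd hf'] at h2
  have h3 : ‖(2 * Real.pi * Complex.I * ξ) • 𝓕 f ξ‖ = 2 * Real.pi * |ξ| * ‖𝓕 f ξ‖ := by
    simp [abs_of_pos Real.pi_pos]
  have h4 : |ξ| * ‖𝓕 f ξ‖ ≤ 2 * Real.pi * |ξ| * ‖𝓕 f ξ‖ := by
    have := Real.pi_gt_three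
    have : 0 ≤ |ξ| * ‖𝓕 f ξ‖ := by positivity
    nlinarith
  simp only [h3] at h2
  linarith

theorem integrable_fourier_mul_fourier {f g : ℝ → ℂ} (hf : Integrable f) (hfd : Differentiable ℝ f)
    (hf' : Integrable (deriv f)) (hg : Integrable g) (hgd : Differentiable ℝ g)
    (hg' : Integrable (deriv g)) : Integrable (fun ξ : ℝ => 𝓕 f ξ * 𝓕 g ξ) := by
  obtain ⟨C, hC⟩ := exists_norm_fourier_mul_le hf hfd hf'
  obtain ⟨D, hD⟩ := exists_norm_fourier_mul_le hg hgd hg'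
  refine Integrable.mono' (integrable_inv_one_add_sq.const_mul (C * D))
    ((continuous_fourier_of_integrable hf).mul
      (continuous_fourier_of_integrable hg)).aestronglyMeasurable (ae_of_all _ fun ξ => ?_)
  rw [norm_mul, ← div_eq_mul_inv, le_div_iff₀ (by positivity)]
  have h1 : 1 + ξ ^ 2 ≤ (1 + |ξ|) * (1 + |ξ|) := by
    have := abs_nonneg ξ
    nlinarith [sq_abs ξ]
  calc ‖𝓕 f ξ‖ * ‖𝓕 g ξ‖ * (1 + ξ ^ 2) ≤ ‖𝓕 f ξ‖ * ‖𝓕 g ξ‖ * ((1 + |ξ|) * (1 + |ξ|)) := by gcongr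
    _ = (‖𝓕 f ξ‖ * (1 + |ξ|)) * (‖𝓕 g ξ‖ * (1 + |ξ|)) := by ring
    _ ≤ C * D := mul_le_mul (hC ξ) (hD ξ) (by positivity) ((by positivity : (0 : ℝ) ≤ _).trans (hC ξ))

/-- The product is the transform of the convolution of f and g, and inversion is evaluated at 0.
Continuity and boundedness of g make the convolution continuous, so that inversion holds pointwise.
-/
theorem integral_fourier_mul_fourier {f g : ℝ → ℂ} (hf : Integrable f) (hg : Integrable g)
    (hgc : Continuous g) (hgb : BddAbove (range fun x => ‖g x‖))
    (hfg : Integrable (fun ξ : ℝ => 𝓕 f ξ * 𝓕 g ξ)) :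
    ∫ ξ : ℝ, 𝓕 f ξ * 𝓕 g ξ = ∫ τ : ℝ, f τ * g (-τ) := by
  have hq : Integrable (f ⋆[ContinuousLinearMap.mul ℂ ℂ] g) := hf.integrable_convolution _ hg
  have hF : 𝓕 (f ⋆[ContinuousLinearMap.mul ℂ ℂ] g) = fun ξ : ℝ => 𝓕 f ξ * 𝓕 g ξ :=
    funext fun ξ => Real.fourier_mul_convolution_eq hf hg ξ
  have hc : Continuous (f ⋆[ContinuousLinearMap.mul ℂ ℂ] g) :=
    hgb.continuous_convolution_right_of_integrable _ hf hgc
  have := congrFun (hc.fourierInv_fourier_eq hq (hF ▸ hfg)) 0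
  rw [hF, Real.fourierInv_eq] at this
  simpa [convolution_def] using this

/-- If two integrable functions vanish on `(-c, ∞)` with `c > 0`, then the truncated integrals of
the product of their Fourier transforms tend to zero. -/
theorem tendsto_integral_fourier_mul_fourier {f g : ℝ → ℂ} {c : ℝ} (hc : 0 < c)
    (hf : Integrable f) (hg : Integrable g) (hf0 : ∀ τ, -c < τ → f τ = 0)
    (hg0 : ∀ τ, -c < τ → g τ = 0) :
    Tendsto (fun p : ℝ × ℝ => ∫ ξ in p.1..p.2, 𝓕 f ξ * 𝓕 g ξ) (atBot ×ˢ atTop) (𝓝 0) := by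
  set q : ℝ → ℂ := f ⋆[ContinuousLinearMap.mul ℂ ℂ] g with hqdef
  have hq : Integrable q := hf.integrable_convolution _ hg
  have hF : 𝓕 q = fun ξ : ℝ => 𝓕 f ξ * 𝓕 g ξ :=
    funext fun ξ => Real.fourier_mul_convolution_eq hf hg ξ
  have hq0 : ∀ τ, -c < τ → q τ = 0 := by
    intro τ hτ
    rw [hqdef, convolution_def]
    refine integral_eq_zero_of_ae (ae_of_all _ fun t => ?_)
    rcases lt_or_ge (-c) t with h | h
    · simp [hf0 t h]
    · simp [hg0 (τ - t) (by linarith)]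
  -- The convolution q vanishes near 0, so division by τ is harmless and makes `𝓕 r` a primitive of
  -- the integrand. Riemann–Lebesgue sends `𝓕 r` to 0 at both ends.
  set r : ℝ → ℂ := fun τ => q τ / (-2 * Real.pi * Complex.I * τ) with hr
  have hpi : (2 * Real.pi : ℝ) ≠ 0 := by positivity
  have hri : Integrable r := by
    refine Integrable.mono (hq.const_mul ((2 * Real.pi * c : ℝ)⁻¹ : ℂ)) ?_ (ae_of_all _ fun τ => ?_)
    · exact hq.aestronglyMeasurable.div₀ (by fun_prop : Measurable fun τ : ℝ =>
        (-2 * Real.pi * Complex.I * τ : ℂ)).aestronglyMeasurable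
    · rcases lt_or_ge (-c) τ with h | h
      · simp [hr, hq0 τ h]
      · have hτ : c ≤ |τ| := by rw [abs_of_neg (by linarith)]; linarith
        simp only [hr, norm_div, norm_mul, norm_inv, Complex.norm_real, Real.norm_eq_abs]
        rw [div_eq_inv_mul]
        simp only [norm_neg, Complex.norm_ofNat, Complex.norm_I, mul_one,
          abs_of_pos Real.pi_pos, abs_of_pos hc, abs_two]
        gcongr
  have hrq : (fun τ : ℝ => (-2 * Real.pi * Complex.I * τ) • r τ) = q := by
    funext τ
    rcases lt_or_ge (-c) τ with h | h
    · simp [hr, hq0 τ h]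
    · have hτ : (τ : ℂ) ≠ 0 := by
        have : τ ≠ 0 := by linarith
        exact_mod_cast this
      simp only [hr, smul_eq_mul]
      rw [mul_div_cancel₀]
      simp [hτ, Real.pi_ne_zero]
  have hri' : Integrable (fun τ : ℝ => τ • r τ) := by
    have := hq.const_mul ((-2 * Real.pi * Complex.I)⁻¹ : ℂ)
    rw [← hrq] at this
    refine this.congr (ae_of_all _ fun τ => ?_)
    have h2 : (-2 * Real.pi * Complex.I : ℂ) ≠ 0 := by simp [Real.pi_ne_zero]
    simp only [smul_eq_mul, Complex.real_smul]
    field_simp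
  have hderiv : ∀ ξ, HasDerivAt (𝓕 r) (𝓕 f ξ * 𝓕 g ξ) ξ := by
    intro ξ
    have := Real.hasDerivAt_fourier hri hri' ξ
    rw [hrq, hF] at this
    exact this
  have hint : ∀ a b : ℝ, ∫ ξ in a..b, 𝓕 f ξ * 𝓕 g ξ = 𝓕 r b - 𝓕 r a := fun a b =>
    intervalIntegral.integral_eq_sub_of_hasDerivAt (fun ξ _ => hderiv ξ)
      (((continuous_fourier_of_integrable hf).mul
        (continuous_fourier_of_integrable hg)).intervalIntegrable _ _)
  simp only [hint]
  have hz := Real.zero_at_infty_fourier r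
  have h1 : Tendsto (𝓕 r) atTop (𝓝 0) := hz.mono_left atTop_le_cocompact
  have h2 : Tendsto (𝓕 r) atBot (𝓝 0) := hz.mono_left atBot_le_cocompact
  simpa using (h1.comp tendsto_snd).sub (h2.comp tendsto_fst)

/-- The integral of a unitary character along an injective phase `φ` against an integrable density
is the Fourier transform of an integrable function supported on the image of `φ`. -/
theorem exists_fourier_eq_integral_phase {s : Set ℝ} (hs : MeasurableSet s) {φ φ' : ℝ → ℝ}
    (hφ : ∀ x ∈ s, HasDerivAt φ (φ' x) x) (hne : ∀ x ∈ s, φ' x ≠ 0) (hinj : InjOn φ s)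
    {g : ℝ → ℂ} (hg : IntegrableOn g s) :
    ∃ n : ℝ → ℂ, Integrable n ∧ (∀ τ, τ ∉ φ '' s → n τ = 0) ∧
      ∀ ξ : ℝ, 𝓕 n ξ = ∫ u in s, Complex.exp (-2 * Real.pi * Complex.I * ξ * φ u) * g u := by
  classical
  set ψ := Function.invFunOn φ s with hψ
  have hψφ : ∀ x ∈ s, ψ (φ x) = x := fun x hx => hinj.leftInvOn_invFunOn hx
  set n₀ : ℝ → ℂ := fun τ => (|φ' (ψ τ)|⁻¹ : ℝ) • g (ψ τ) with hn₀
  have hφw : ∀ x ∈ s, HasDerivWithinAt φ (φ' x) s x := fun x hx => (hφ x hx).hasDerivWithinAt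
  have hmeas : MeasurableSet (φ '' s) := by
    refine hs.image_of_continuousOn_injOn (fun x hx => (hφ x hx).continuousAt.continuousWithinAt)
      hinj
  have key : ∀ x ∈ s, |φ' x| • n₀ (φ x) = g x := by
    intro x hx
    have := abs_ne_zero.2 (hne x hx)
    simp only [hn₀, hψφ x hx, smul_smul, mul_inv_cancel₀ this, one_smul]
  have hn₀i : IntegrableOn n₀ (φ '' s) := by
    rw [integrableOn_image_iff_integrableOn_abs_deriv_smul hs hφw hinj]
    exact hg.congr_fun (fun x hx => (key x hx).symm) hs
  refine ⟨(φ '' s).indicator n₀, hn₀i.integrable_indicator hmeas,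
    fun τ hτ => indicator_of_notMem hτ _, fun ξ => ?_⟩
  rw [Real.fourier_real_eq_integral_exp_smul]
  have : ∀ v : ℝ, Complex.exp (↑(-2 * Real.pi * v * ξ) * Complex.I) • (φ '' s).indicator n₀ v
      = (φ '' s).indicator
        (fun v => Complex.exp (↑(-2 * Real.pi * v * ξ) * Complex.I) • n₀ v) v := by
    intro v
    by_cases hv : v ∈ φ '' s <;> simp [hv]
  simp_rw [this]
  rw [integral_indicator hmeas, integral_image_eq_integral_abs_deriv_smul hs hφw hinj]
  refine setIntegral_congr_fun hs fun x hx => ?_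
  rw [smul_comm, key x hx, smul_eq_mul]
  congr 2
  push_cast
  ring

/-! ### Beta integrals on (1, ∞) -/

theorem ofReal_cpow_eq_exp {x : ℝ} (hx : 0 < x) (s : ℂ) :
    (x : ℂ) ^ s = Complex.exp (Real.log x * s) := by
  rw [Complex.cpow_def_of_ne_zero (by exact_mod_cast hx.ne'), Complex.ofReal_log hx.le]

theorem image_inv_Ioi_one : (fun u : ℝ => u⁻¹) '' Ioi 1 = Ioo 0 1 := by
  ext x
  simp only [mem_image, mem_Ioi, mem_Ioo]
  constructor
  · rintro ⟨u, hu, rfl⟩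
    exact ⟨by positivity, inv_lt_one_of_one_lt₀ hu⟩
  · rintro ⟨h0, h1⟩
    exact ⟨x⁻¹, (one_lt_inv₀ h0).2 h1, inv_inv x⟩

/-- Jacobian and integrand of the inversion x = 1/u, which carries B(-p-q, q) from (0, 1) to (1, ∞).
-/
theorem beta_inv_substitution {p q : ℂ} {u : ℝ} (hu : 1 < u) :
    |(-(u ^ 2)⁻¹ : ℝ)| • (((u⁻¹ : ℝ) : ℂ) ^ (-p - q - 1) * (1 - ((u⁻¹ : ℝ) : ℂ)) ^ (q - 1)) =
      (u : ℂ) ^ p * ((u - 1 : ℝ) : ℂ) ^ (q - 1) := by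
  have h0 : 0 < u := by linarith
  have h1 : 0 < u - 1 := by linarith
  have e : (1 - ((u⁻¹ : ℝ) : ℂ)) = (((u - 1) / u : ℝ) : ℂ) := by
    push_cast
    have : (u : ℂ) ≠ 0 := by exact_mod_cast h0.ne'
    field_simp
  have e2 : |(-(u ^ 2)⁻¹ : ℝ)| = Real.exp (-2 * Real.log u) := by
    rw [abs_neg, abs_of_pos (by positivity), neg_mul, Real.exp_neg, two_mul, Real.exp_add,
      Real.exp_log h0, sq]
  rw [e, e2, ofReal_cpow_eq_exp (inv_pos.2 h0), ofReal_cpow_eq_exp (div_pos h1 h0),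
    ofReal_cpow_eq_exp h0, ofReal_cpow_eq_exp h1, Real.log_inv, Real.log_div h1.ne' h0.ne',
    Complex.real_smul, Complex.ofReal_exp, ← Complex.exp_add, ← Complex.exp_add,
    ← Complex.exp_add]
  congr 1
  push_cast
  ring

theorem integrableOn_beta_Ioi {p q : ℂ} (hq : 0 < q.re) (hpq : 0 < (-p - q).re) :
    IntegrableOn (fun u : ℝ => (u : ℂ) ^ p * ((u - 1 : ℝ) : ℂ) ^ (q - 1)) (Ioi 1) := by
  have h := (intervalIntegrable_iff_integrableOn_Ioo_of_le zero_le_one).1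
    (Complex.betaIntegral_convergent hpq hq)
  rw [← image_inv_Ioi_one, integrableOn_image_iff_integrableOn_abs_deriv_smul measurableSet_Ioi
    (fun x hx => (hasDerivAt_inv (by linarith [mem_Ioi.1 hx] : x ≠ 0)).hasDerivWithinAt)
    (inv_injective.injOn)] at h
  exact h.congr_fun (fun u hu => beta_inv_substitution hu) measurableSet_Ioi

theorem integral_beta_Ioi (p q : ℂ) :
    ∫ u in Ioi (1 : ℝ), (u : ℂ) ^ p * ((u - 1 : ℝ) : ℂ) ^ (q - 1) =
      Complex.betaIntegral (-p - q) q := by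
  rw [Complex.betaIntegral, intervalIntegral.integral_of_le zero_le_one,
    integral_Ioc_eq_integral_Ioo, ← image_inv_Ioi_one,
    integral_image_eq_integral_abs_deriv_smul measurableSet_Ioi
    (fun x hx => (hasDerivAt_inv (by linarith [mem_Ioi.1 hx] : x ≠ 0)).hasDerivWithinAt)
    (inv_injective.injOn)]
  exact setIntegral_congr_fun measurableSet_Ioi fun u hu => (beta_inv_substitution hu).symm

theorem integrableOn_beta_Ioi_real {p q : ℝ} (hq : 0 < q) (hpq : p + q < 0) :
    IntegrableOn (fun u : ℝ => u ^ p * (u - 1) ^ (q - 1)) (Ioi 1) := by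
  have h := integrableOn_beta_Ioi (p := p) (q := q) (by simpa using hq)
    (by simp; linarith)
  have h : IntegrableOn (fun u : ℝ => ((u : ℂ) ^ (p : ℂ) * ((u - 1 : ℝ) : ℂ) ^ ((q : ℂ) - 1)).re)
    (Ioi 1) := Integrable.re h
  refine IntegrableOn.congr_fun h (fun u hu => ?_) measurableSet_Ioi
  have hu1 : 1 < u := hu
  have e : ((u : ℂ) ^ (p : ℂ) * ((u - 1 : ℝ) : ℂ) ^ ((q : ℂ) - 1)) =
      ((u ^ p * (u - 1) ^ (q - 1) : ℝ) : ℂ) := by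
    rw [Complex.ofReal_mul, Complex.ofReal_cpow (by linarith), Complex.ofReal_cpow (by linarith)]
    push_cast
    rfl
  simp only [e]
  exact Complex.ofReal_re _

/-! ### The density in τ = log(u(u-1)) over u(u-1) > 0 -/

/-- The larger root of `u (u - 1) = w`. -/
noncomputable def upperRoot (w : ℝ) : ℝ := (1 + Real.sqrt (1 + 4 * w)) / 2

/-- The sum over the two roots of `u (u - 1) = w` of `|u|^{-l} / |2 u - 1|`, for `w > 0`. -/
noncomputable def rootDensity (l w : ℝ) : ℝ :=
  (upperRoot w ^ (-l) + (upperRoot w - 1) ^ (-l)) / Real.sqrt (1 + 4 * w)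

/-- The density of the pushforward in the logarithmic coordinate `τ = log w`. -/
noncomputable def logDensity (a l τ : ℝ) : ℝ :=
  Real.exp (a * τ) * rootDensity l (Real.exp τ)

/-- The density in the coordinate `u > 1` with `u (u - 1) = w`. -/
noncomputable def rootWeight (a l u : ℝ) : ℝ :=
  (u * (u - 1)) ^ (a - 1) * (u ^ (-l) + (u - 1) ^ (-l))

theorem one_lt_upperRoot {w : ℝ} (hw : 0 < w) : 1 < upperRoot w := by
  have : 1 < Real.sqrt (1 + 4 * w) := Real.lt_sqrt_of_sq_lt (by linarith)
  unfold upperRoot; linarith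

theorem upperRoot_mul {w : ℝ} (hw : 0 < w) : upperRoot w * (upperRoot w - 1) = w := by
  have := Real.sq_sqrt (by linarith : 0 ≤ 1 + 4 * w)
  unfold upperRoot; nlinarith

theorem sqrt_one_add_four_mul {u : ℝ} (hu : 1 < u) :
    Real.sqrt (1 + 4 * (u * (u - 1))) = 2 * u - 1 := by
  rw [show 1 + 4 * (u * (u - 1)) = (2 * u - 1) ^ 2 by ring, Real.sqrt_sq (by linarith)]

theorem upperRoot_of_one_lt {u : ℝ} (hu : 1 < u) : upperRoot (u * (u - 1)) = u := by
  rw [upperRoot, sqrt_one_add_four_mul hu]; ring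

theorem rootDensity_of_one_lt {l u : ℝ} (hu : 1 < u) :
    rootDensity l (u * (u - 1)) = (u ^ (-l) + (u - 1) ^ (-l)) / (2 * u - 1) := by
  rw [rootDensity, upperRoot_of_one_lt hu, sqrt_one_add_four_mul hu]

theorem rootDensity_nonneg {l w : ℝ} (hw : 0 < w) : 0 ≤ rootDensity l w := by
  have h := one_lt_upperRoot hw
  have h1 : 0 < upperRoot w - 1 := by linarith
  have h2 : 0 < upperRoot w := by linarith
  unfold rootDensity; positivity

theorem mul_sub_one_pos {u : ℝ} (hu : 1 < u) : 0 < u * (u - 1) :=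
  mul_pos (by linarith) (by linarith)

theorem image_log_mul_Ioi_one : (fun u : ℝ => Real.log (u * (u - 1))) '' Ioi 1 = univ := by
  refine eq_univ_of_forall fun τ => ⟨upperRoot (Real.exp τ), one_lt_upperRoot (Real.exp_pos τ), ?_⟩
  simp [upperRoot_mul (Real.exp_pos τ)]

theorem injOn_log_mul_Ioi_one : InjOn (fun u : ℝ => Real.log (u * (u - 1))) (Ioi 1) := by
  intro u hu v hv huv
  have := Real.log_injOn_pos (mul_sub_one_pos hu) (mul_sub_one_pos hv) huv
  rw [← upperRoot_of_one_lt hu, this, upperRoot_of_one_lt hv]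

theorem hasDerivAt_log_mul {u : ℝ} (hu : u * (u - 1) ≠ 0) :
    HasDerivAt (fun u : ℝ => Real.log (u * (u - 1))) ((2 * u - 1) / (u * (u - 1))) u := by
  have h : HasDerivAt (fun u : ℝ => u * (u - 1)) (2 * u - 1) u := by
    convert! (hasDerivAt_id u).mul ((hasDerivAt_id u).sub_const 1) using 1
    simp; ring
  exact h.log hu

theorem abs_deriv_mul_logDensity {a l u : ℝ} (hu : 1 < u) :
    |(2 * u - 1) / (u * (u - 1))| * logDensity a l (Real.log (u * (u - 1))) =
      rootWeight a l u := by
  have h := mul_sub_one_pos hu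
  have h2 : 0 < 2 * u - 1 := by linarith
  rw [abs_of_pos (by positivity), logDensity, Real.exp_log h, rootDensity_of_one_lt hu, mul_comm a,
    ← Real.rpow_def_of_pos h, rootWeight, Real.rpow_sub_one h.ne']
  field_simp

/-- Expanding gives two Beta integrands. Convergence at u = 1 needs 0 < a and l < a; convergence at
infinity needs 2a < 1 + l. These inequalities recur throughout. -/
theorem integrableOn_rootWeight {a l : ℝ} (h0 : 0 < a) (h1 : l < a) (h2 : 2 * a < 1 + l) :
    IntegrableOn (rootWeight a l) (Ioi 1) := by
  have i1 := integrableOn_beta_Ioi_real (p := a - 1 - l) h0 (by linarith)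
  have i2 := integrableOn_beta_Ioi_real (p := a - 1) (q := a - l) (by linarith) (by linarith)
  refine (i1.add i2).congr_fun (fun u hu => ?_) measurableSet_Ioi
  have hu1 : 1 < u := hu
  have e0 : 0 < u := by linarith
  have e1 : 0 < u - 1 := by linarith
  simp only [Pi.add_apply, rootWeight]
  rw [Real.mul_rpow e0.le e1.le, mul_add, show a - 1 - l = (a - 1) + -l by ring,
    show a - l - 1 = (a - 1) + -l by ring, Real.rpow_add e0, Real.rpow_add e1]
  ring

/-- Change of variables `τ = log (u (u - 1))`. -/
theorem integral_mul_logDensity (a l : ℝ) (f : ℝ → ℂ) :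
    ∫ τ : ℝ, f τ * logDensity a l τ =
      ∫ u in Ioi (1 : ℝ), f (Real.log (u * (u - 1))) * rootWeight a l u := by
  rw [← setIntegral_univ, ← image_log_mul_Ioi_one, integral_image_eq_integral_abs_deriv_smul
    measurableSet_Ioi (fun u hu => (hasDerivAt_log_mul (mul_sub_one_pos hu).ne').hasDerivWithinAt)
    injOn_log_mul_Ioi_one]
  refine setIntegral_congr_fun measurableSet_Ioi fun u hu => ?_
  rw [← abs_deriv_mul_logDensity hu, Complex.real_smul]
  push_cast
  ring

theorem integrable_logDensity {a l : ℝ} (h0 : 0 < a) (h1 : l < a) (h2 : 2 * a < 1 + l) :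
    Integrable (logDensity a l) := by
  rw [← integrableOn_univ, ← image_log_mul_Ioi_one,
    integrableOn_image_iff_integrableOn_abs_deriv_smul
    measurableSet_Ioi (fun u hu => (hasDerivAt_log_mul (mul_sub_one_pos hu).ne').hasDerivWithinAt)
    injOn_log_mul_Ioi_one]
  exact (integrableOn_rootWeight h0 h1 h2).congr_fun
    (fun u hu => (abs_deriv_mul_logDensity hu).symm) measurableSet_Ioi

/-- The density is a sum of two exponentials whose exponents have bounded derivative, so
integrability of the density passes to its derivative. -/
theorem exists_hasDerivAt_logDensity (a l τ : ℝ) :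
    ∃ d, HasDerivAt (logDensity a l) d τ ∧ |d| ≤ (|a| + |l| + 1) * logDensity a l τ := by
  set e := Real.exp τ with he
  have e0 : 0 < e := Real.exp_pos τ
  set S := Real.sqrt (1 + 4 * e) with hS
  have hS2 : S ^ 2 = 1 + 4 * e := Real.sq_sqrt (by linarith)
  have S1 : 1 < S := Real.lt_sqrt_of_sq_lt (by linarith)
  have S0 : 0 < S := by linarith
  have hU : upperRoot e = (1 + S) / 2 := rfl
  have hU1 : upperRoot e - 1 = (S - 1) / 2 := by rw [hU]; ring
  have dS : HasDerivAt (fun τ => Real.sqrt (1 + 4 * Real.exp τ)) (2 * e / S) τ := by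
    have := (((Real.hasDerivAt_exp τ).const_mul 4).const_add 1).sqrt
      (by positivity : 1 + 4 * Real.exp τ ≠ 0)
    convert! this using 1
    rw [← he, ← hS]; field_simp; ring
  have dU : HasDerivAt (fun τ => upperRoot (Real.exp τ)) (e / S) τ := by
    convert! (dS.const_add 1).div_const 2 using 1
    field_simp
  have U0 : 0 < (1 + S) / 2 := by linarith
  have U1 : 0 < (S - 1) / 2 := by linarith
  set A := fun τ => a * τ - l * Real.log (upperRoot (Real.exp τ)) -
    Real.log (Real.sqrt (1 + 4 * Real.exp τ)) with hA
  set B := fun τ => a * τ - l * Real.log (upperRoot (Real.exp τ) - 1) -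
    Real.log (Real.sqrt (1 + 4 * Real.exp τ)) with hB
  have hAB : logDensity a l = fun τ => Real.exp (A τ) + Real.exp (B τ) := by
    funext t
    have h1 := one_lt_upperRoot (Real.exp_pos t)
    have h2 : 0 < Real.sqrt (1 + 4 * Real.exp t) := by positivity
    simp only [logDensity, rootDensity, hA, hB]
    rw [Real.rpow_def_of_pos (by linarith), Real.rpow_def_of_pos (by linarith)]
    simp only [Real.exp_sub, Real.exp_log h2, mul_neg, Real.exp_neg, mul_comm l]
    field_simp
  have dA : HasDerivAt A (a - l * ((e / S) / ((1 + S) / 2)) - (2 * e / S) / S) τ := by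
    have := (((hasDerivAt_id τ).const_mul a).sub
      ((dU.log (by rw [← he, hU]; exact U0.ne')).const_mul l)).sub
      (dS.log (by rw [← he, ← hS]; exact S0.ne'))
    convert! this using 1
    simp [← he, ← hS, hU]
  have dB : HasDerivAt B (a - l * ((e / S) / ((S - 1) / 2)) - (2 * e / S) / S) τ := by
    have := (((hasDerivAt_id τ).const_mul a).sub
      (((dU.sub_const 1).log (by rw [← he, hU1]; exact U1.ne')).const_mul l)).sub
      (dS.log (by rw [← he, ← hS]; exact S0.ne'))
    convert! this using 1
    simp [← he, ← hS, hU1]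
  have bound : ∀ x y : ℝ, |x| ≤ 1 → |y| ≤ 1 → |a - l * x - y| ≤ |a| + |l| + 1 := by
    intro x y hx hy
    have h1 : |l * x| ≤ |l| := by rw [abs_mul]; nlinarith [abs_nonneg l]
    have h2 := abs_sub (a - l * x) y
    have h3 := abs_sub a (l * x)
    linarith
  -- Since 4e = S² - 1, the three quotients are (S²-1)/(2S²), (S-1)/(2S) and (S+1)/(2S).
  have bS : |(2 * e / S) / S| ≤ 1 := by
    rw [abs_of_pos (by positivity), div_div, div_le_one (by positivity)]; nlinarith
  have bA : |(e / S) / ((1 + S) / 2)| ≤ 1 := by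
    rw [abs_of_pos (by positivity), div_div, div_le_one (by positivity)]; nlinarith
  have bB : |(e / S) / ((S - 1) / 2)| ≤ 1 := by
    rw [abs_of_pos (by positivity), div_div, div_le_one (by positivity)]; nlinarith
  rw [hAB]
  refine ⟨_, dA.exp.add dB.exp, ?_⟩
  refine (abs_add_le _ _).trans ?_
  rw [abs_mul, abs_mul, abs_of_pos (Real.exp_pos _), abs_of_pos (Real.exp_pos _), mul_add]
  have h1 := bound _ _ bA bS
  have h2 := bound _ _ bB bS
  have h3 := Real.exp_pos (A τ)
  have h4 := Real.exp_pos (B τ)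
  nlinarith

theorem differentiable_logDensity (a l : ℝ) : Differentiable ℝ fun τ => (logDensity a l τ : ℂ) :=
  fun τ => (exists_hasDerivAt_logDensity a l τ).choose_spec.1.ofReal_comp.differentiableAt

theorem integrable_deriv_logDensity {a l : ℝ} (h0 : 0 < a) (h1 : l < a) (h2 : 2 * a < 1 + l) :
    Integrable (deriv fun τ => (logDensity a l τ : ℂ)) := by
  refine Integrable.mono' ((integrable_logDensity h0 h1 h2).const_mul (|a| + |l| + 1))
    (measurable_deriv _).aestronglyMeasurable (ae_of_all _ fun τ => ?_)
  obtain ⟨d, hd, hd'⟩ := exists_hasDerivAt_logDensity a l τ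
  rw [hd.ofReal_comp.deriv]
  simpa using hd'

theorem bddAbove_range_norm_of_integrable_deriv {f : ℝ → ℂ} (hf : Differentiable ℝ f)
    (hf' : Integrable (deriv f)) : BddAbove (range fun x => ‖f x‖) := by
  refine ⟨‖f 0‖ + ∫ x, ‖deriv f x‖, ?_⟩
  rintro _ ⟨x, rfl⟩
  have h := intervalIntegral.integral_deriv_eq_sub (a := 0) (b := x) (fun t _ => hf t)
    hf'.intervalIntegrable
  have h1 : ‖f x - f 0‖ ≤ ∫ x, ‖deriv f x‖ := by
    rw [← h]
    refine intervalIntegral.norm_integral_le_integral_norm_uIoc.trans ?_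
    exact setIntegral_le_integral hf'.norm (ae_of_all _ fun _ => norm_nonneg _)
  calc ‖f x‖ = ‖f 0 + (f x - f 0)‖ := by ring_nf
    _ ≤ ‖f 0‖ + ‖f x - f 0‖ := norm_add_le _ _
    _ ≤ _ := by linarith

/-! ### The Fourier transform of the density -/

/-- Reflection of Γ at z - l, z and 2z - l, with A = π(z - l/2) and B = πl/2, reduces the sum to
B(z, z-l) (sin(A-B) + sin(A+B)) / sin 2A, and the trigonometric factor is cos B / cos A. -/
theorem betaIntegral_add_betaIntegral {l : ℝ} {z : ℂ} (h0 : 0 < z.re) (h1 : l < z.re)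
    (h2 : 2 * z.re < 1 + l) :
    Complex.cos (Real.pi * (z - l / 2)) ≠ 0 ∧
    Complex.betaIntegral (1 + l - 2 * z) z + Complex.betaIntegral (1 + l - 2 * z) (z - l) =
      Complex.betaIntegral z (z - l) * Complex.cos (Real.pi * (l / 2)) /
        Complex.cos (Real.pi * (z - l / 2)) := by
  have r1 : 0 < (1 + l - 2 * z : ℂ).re := by simp; linarith
  have r2 : 0 < (z - l : ℂ).re := by simp; linarith
  have r3 : 0 < (1 - (z - l) : ℂ).re := by simp; linarith
  have r4 : 0 < (1 - z : ℂ).re := by simp; linarith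
  have r5 : 0 < (2 * z - l : ℂ).re := by simp; linarith
  have r6 : 0 < (1 - (2 * z - l) : ℂ).re := by simp; linarith
  rw [Complex.betaIntegral_eq_Gamma_mul_div _ _ r1 h0, Complex.betaIntegral_eq_Gamma_mul_div _ _ r1 r2,
    Complex.betaIntegral_eq_Gamma_mul_div _ _ h0 r2]
  rw [show (1 + l - 2 * z + z : ℂ) = 1 - (z - l) by ring,
    show (1 + l - 2 * z + (z - l) : ℂ) = 1 - z by ring,
    show (z + (z - l) : ℂ) = 2 * z - l by ring,
    show (1 + l - 2 * z : ℂ) = 1 - (2 * z - l) by ring]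
  have E1 := Complex.Gamma_mul_Gamma_one_sub (z - l)
  have E2 := Complex.Gamma_mul_Gamma_one_sub z
  have E3 := Complex.Gamma_mul_Gamma_one_sub (2 * z - l)
  have n1 := Complex.Gamma_ne_zero_of_re_pos h0
  have n2 := Complex.Gamma_ne_zero_of_re_pos r2
  have n3 := Complex.Gamma_ne_zero_of_re_pos r3
  have n4 := Complex.Gamma_ne_zero_of_re_pos r4
  have n5 := Complex.Gamma_ne_zero_of_re_pos r5
  have n6 := Complex.Gamma_ne_zero_of_re_pos r6
  have hp : (Real.pi : ℂ) ≠ 0 := by exact_mod_cast Real.pi_ne_zero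
  set A : ℂ := Real.pi * (z - l / 2) with hA
  set B : ℂ := Real.pi * (l / 2) with hB
  rw [show (Real.pi * (z - l) : ℂ) = A - B by rw [hA, hB]; ring, Complex.sin_sub] at E1
  rw [show (Real.pi * z : ℂ) = A + B by rw [hA, hB]; ring, Complex.sin_add] at E2
  rw [show (Real.pi * (2 * z - l) : ℂ) = 2 * A by rw [hA]; ring, Complex.sin_two_mul] at E3
  generalize Complex.Gamma (z - l) = G2 at *
  generalize Complex.Gamma (1 - (z - l)) = H1 at *
  generalize Complex.Gamma z = G1 at *
  generalize Complex.Gamma (1 - z) = H2 at *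
  generalize Complex.Gamma (2 * z - l) = K at *
  generalize Complex.Gamma (1 - (2 * z - l)) = g at *
  generalize Complex.sin A = sA at *
  generalize Complex.cos A = cA at *
  generalize Complex.sin B = sB at *
  generalize Complex.cos B = cB at *
  -- A vanishing sine would make the right side of the reflection formula 0, as x / 0 = 0, whereas
  -- the Gamma values are nonzero.
  have d3 : 2 * sA * cA ≠ 0 := fun h => by
    rw [h, div_zero] at E3; exact mul_ne_zero n5 n6 E3
  have d1 : sA * cB - cA * sB ≠ 0 := fun h => by
    rw [h, div_zero] at E1; exact mul_ne_zero n2 n3 E1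
  have d2 : sA * cB + cA * sB ≠ 0 := fun h => by
    rw [h, div_zero] at E2; exact mul_ne_zero n1 n4 E2
  have dc : cA ≠ 0 := fun h => d3 (by rw [h, mul_zero])
  have ds : sA ≠ 0 := fun h => d3 (by rw [h, mul_zero, zero_mul])
  refine ⟨dc, ?_⟩
  rw [eq_div_iff d1] at E1
  rw [eq_div_iff d2] at E2
  rw [eq_div_iff d3] at E3
  have F1 : H1⁻¹ = G2 * (sA * cB - cA * sB) / Real.pi := by
    rw [← E1]; field_simp
  have F2 : H2⁻¹ = G1 * (sA * cB + cA * sB) / Real.pi := by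
    rw [← E2]; field_simp
  have F3 : K⁻¹ = g * (2 * sA * cA) / Real.pi := by
    rw [← E3]; field_simp
  rw [div_eq_mul_inv, div_eq_mul_inv (g * G2), div_eq_mul_inv (G1 * G2), F1, F2, F3]
  field_simp
  ring

theorem exp_mul_rootWeight {a l u : ℝ} (hu : 1 < u) (ξ : ℝ) {z : ℂ}
    (hz : z = a - 2 * Real.pi * Complex.I * ξ) :
    Complex.exp (-2 * Real.pi * Complex.I * ξ * Real.log (u * (u - 1))) * rootWeight a l u =
      (u : ℂ) ^ (z - 1 - l) * ((u - 1 : ℝ) : ℂ) ^ (z - 1) +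
        (u : ℂ) ^ (z - 1) * ((u - 1 : ℝ) : ℂ) ^ (z - l - 1) := by
  have h0 : 0 < u := by linarith
  have h1 : 0 < u - 1 := by linarith
  rw [ofReal_cpow_eq_exp h0, ofReal_cpow_eq_exp h0, ofReal_cpow_eq_exp h1, ofReal_cpow_eq_exp h1,
    rootWeight, Real.rpow_def_of_pos (mul_sub_one_pos hu), Real.rpow_def_of_pos h0,
    Real.rpow_def_of_pos h1, Real.log_mul h0.ne' h1.ne']
  push_cast
  rw [← Complex.exp_add, ← Complex.exp_add, mul_add (Complex.exp _), ← Complex.exp_add,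
    ← Complex.exp_add, mul_add (Complex.exp _), ← Complex.exp_add, ← Complex.exp_add, hz]
  congr 2 <;> ring

/-- The character shifts the exponent a to the complex number z, and the two terms of `rootWeight`
become the two Beta integrals just summed. -/
theorem fourier_logDensity {a l : ℝ} (h0 : 0 < a) (h1 : l < a) (h2 : 2 * a < 1 + l) (ξ : ℝ) {z : ℂ}
    (hz : z = a - 2 * Real.pi * Complex.I * ξ) :
    𝓕 (fun τ => (logDensity a l τ : ℂ)) ξ =
      Complex.betaIntegral z (z - l) * Complex.cos (Real.pi * (l / 2)) /
        Complex.cos (Real.pi * (z - l / 2)) := by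
  have hre : z.re = a := by simp [hz]
  rw [← (betaIntegral_add_betaIntegral (l := l) (z := z) (by rwa [hre]) (by rwa [hre])
    (by rwa [hre])).2, Real.fourier_real_eq_integral_exp_smul]
  have e : ∀ v : ℝ, Complex.exp (↑(-2 * Real.pi * v * ξ) * Complex.I) • (logDensity a l v : ℂ) =
      (fun τ : ℝ => Complex.exp (-2 * Real.pi * Complex.I * ξ * τ)) v * logDensity a l v := by
    intro v
    simp only [smul_eq_mul]
    congr 2
    push_cast; ring
  simp_rw [e]
  rw [integral_mul_logDensity, setIntegral_congr_fun measurableSet_Ioi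
    (fun u hu => exp_mul_rootWeight hu ξ hz), integral_add]
  · rw [integral_beta_Ioi, integral_beta_Ioi]
    congr 2 <;> ring
  · exact integrableOn_beta_Ioi (by rwa [hre]) (by simp [hre]; linarith)
  · exact integrableOn_beta_Ioi (by simp [hre]; linarith) (by simp [hre]; linarith)

/-! ### The common value of the integrals -/

/-- The common value of the state integral, the Mellin–Barnes integral and the period. -/
noncomputable def knotIntegral (l m : ℝ) : ℝ :=
  ∫ τ : ℝ, Real.exp (m * τ) * (rootDensity l (Real.exp τ) * rootDensity l (Real.exp (-τ)))

theorem logDensity_mul_logDensity_neg (a b l τ : ℝ) :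
    logDensity a l τ * logDensity b l (-τ) =
      Real.exp ((a - b) * τ) * (rootDensity l (Real.exp τ) * rootDensity l (Real.exp (-τ))) := by
  rw [logDensity, logDensity, sub_mul, Real.exp_sub, mul_neg, Real.exp_neg (b * τ)]
  field_simp

theorem integral_logDensity_mul_logDensity_neg (a b l : ℝ) :
    ∫ τ, logDensity a l τ * logDensity b l (-τ) = knotIntegral l (b - a) := by
  rw [← integral_neg_eq_self, knotIntegral]
  congr 1; funext τ
  rw [logDensity_mul_logDensity_neg, neg_neg]
  congr 1
  · congr 1; ring
  · ring

theorem integrable_ofReal_logDensity {a l : ℝ} (h0 : 0 < a) (h1 : l < a) (h2 : 2 * a < 1 + l) :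
    Integrable fun τ => (logDensity a l τ : ℂ) :=
  (integrable_logDensity h0 h1 h2).ofReal

theorem integrable_fourier_logDensity_mul {a b l : ℝ} (ha0 : 0 < a) (ha1 : l < a)
    (ha2 : 2 * a < 1 + l) (hb0 : 0 < b) (hb1 : l < b) (hb2 : 2 * b < 1 + l) :
    Integrable fun ξ : ℝ => 𝓕 (fun τ => (logDensity a l τ : ℂ)) ξ *
      𝓕 (fun τ => (logDensity b l τ : ℂ)) ξ :=
  integrable_fourier_mul_fourier (integrable_ofReal_logDensity ha0 ha1 ha2)
    (differentiable_logDensity a l) (integrable_deriv_logDensity ha0 ha1 ha2)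
    (integrable_ofReal_logDensity hb0 hb1 hb2)
    (differentiable_logDensity b l) (integrable_deriv_logDensity hb0 hb1 hb2)

theorem integral_fourier_logDensity_mul {a b l : ℝ} (ha0 : 0 < a) (ha1 : l < a)
    (ha2 : 2 * a < 1 + l) (hb0 : 0 < b) (hb1 : l < b) (hb2 : 2 * b < 1 + l) :
    ∫ ξ : ℝ, 𝓕 (fun τ => (logDensity a l τ : ℂ)) ξ * 𝓕 (fun τ => (logDensity b l τ : ℂ)) ξ =
      knotIntegral l (b - a) := by
  rw [integral_fourier_mul_fourier (integrable_ofReal_logDensity ha0 ha1 ha2)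
    (integrable_ofReal_logDensity hb0 hb1 hb2) (differentiable_logDensity b l).continuous
    (bddAbove_range_norm_of_integrable_deriv (differentiable_logDensity b l)
      (integrable_deriv_logDensity hb0 hb1 hb2))
    (integrable_fourier_logDensity_mul ha0 ha1 ha2 hb0 hb1 hb2),
    ← integral_logDensity_mul_logDensity_neg, ← integral_complex_ofReal]
  simp

/-- The integrand defining `knotIntegral` is integrable whenever the contour strip is nonempty. -/
theorem integrable_knotIntegrand {a b l : ℝ} (ha0 : 0 < a) (ha1 : l < a)
    (ha2 : 2 * a < 1 + l) (hb0 : 0 < b) (hb1 : l < b) (hb2 : 2 * b < 1 + l) :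
    Integrable fun τ : ℝ => Real.exp ((b - a) * τ) *
      (rootDensity l (Real.exp τ) * rootDensity l (Real.exp (-τ))) := by
  simp_rw [← logDensity_mul_logDensity_neg]
  obtain ⟨C, hC⟩ := bddAbove_range_norm_of_integrable_deriv (differentiable_logDensity a l)
      (integrable_deriv_logDensity ha0 ha1 ha2)
  refine (integrable_logDensity hb0 hb1 hb2).mul_bdd (c := C) ?_ (ae_of_all _ fun τ => ?_)
  · exact ((integrable_logDensity ha0 ha1 ha2).comp_neg).aestronglyMeasurable
  · have := hC (mem_range_self (-τ))
    simpa using this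

/-! ### The Mellin–Barnes integral -/

/-- The factors at z and z + m are transforms at the same frequency ξ, for the exponents ε and ε +
m. The strip conditions are the convergence inequalities for these two exponents. -/
theorem mellinBarnesIntegrand_eq_fourier {l m ε : ℝ} (hε : ε ∈ contourStrip l m) (ξ : ℝ) :
    mellinBarnesIntegrand l m (ε + (-2 * Real.pi * ξ : ℝ) * Complex.I) =
      𝓕 (fun τ => (logDensity ε l τ : ℂ)) ξ * 𝓕 (fun τ => (logDensity (ε + m) l τ : ℂ)) ξ := by
  obtain ⟨h1, h2, h3, h4, h5, h6⟩ := hε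
  rw [fourier_logDensity h1 (by linarith) (by linarith) ξ
      (z := ε + (-2 * Real.pi * ξ : ℝ) * Complex.I) (by push_cast; ring),
    fourier_logDensity h3 (by linarith) (by linarith) ξ
      (z := ε + (-2 * Real.pi * ξ : ℝ) * Complex.I + m) (by push_cast; ring),
    mellinBarnesIntegrand]
  rw [div_mul_div_comm]
  ring

theorem verticalIntegrable_mellinBarnesIntegrand {l m ε : ℝ} (hε : ε ∈ contourStrip l m) :
    VerticalIntegrable (mellinBarnesIntegrand l m) ε := by
  have hε' := hε
  obtain ⟨h1, h2, h3, h4, h5, h6⟩ := hε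
  have h := integrable_fourier_logDensity_mul (l := l) h1 (by linarith) (by linarith) h3
    (by linarith) (by linarith)
  simp_rw [← mellinBarnesIntegrand_eq_fourier hε'] at h
  exact (integrable_comp_mul_left_iff
    (fun t : ℝ => mellinBarnesIntegrand l m (ε + t * Complex.I))
    (by simp [Real.pi_ne_zero] : -2 * Real.pi ≠ 0)).1 h

theorem verticalIntegral_mellinBarnesIntegrand {l m ε : ℝ} (hε : ε ∈ contourStrip l m) :
    1 / (2 * Real.pi * Complex.I) * verticalIntegral (mellinBarnesIntegrand l m) ε =
      knotIntegral l m := by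
  have hε' := hε
  obtain ⟨h1, h2, h3, h4, h5, h6⟩ := hε
  have h := integral_fourier_logDensity_mul (l := l) h1 (by linarith) (by linarith) h3
    (by linarith) (by linarith)
  simp_rw [← mellinBarnesIntegrand_eq_fourier hε'] at h
  rw [Measure.integral_comp_mul_left
    (fun t : ℝ => mellinBarnesIntegrand l m (ε + t * Complex.I)) (-2 * Real.pi),
    add_sub_cancel_left] at h
  rw [← h, verticalIntegral, integral_mul_const, abs_inv, abs_mul, abs_of_pos Real.pi_pos,
    abs_neg, abs_two, Complex.real_smul]
  have hp : (Real.pi : ℂ) ≠ 0 := by exact_mod_cast Real.pi_ne_zero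
  push_cast
  field_simp

/-! ### The period integral -/

/-- If U > 1 and U(U-1) = 1/w, then y = (1-x)(2U-1), so y+x-1 = 2(1-x)(U-1) and -y+x-1 = -2(1-x)U.
The relations 1/U = w(U-1) and 1/(U-1) = wU turn the l-th powers into the numerator of
`rootDensity`. -/
theorem periodIntegrand_eq {x : ℝ} (l m : ℝ) (hx : x < 1) (hx0 : x ≠ 0) {w : ℝ}
    (hw : w = (1 - x) / x ^ 2) :
    periodIntegrand l m x = w ^ m * |x| ^ l * rootDensity l w⁻¹ / (1 - x) := by
  have hE : 0 < 1 - x := by linarith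
  have hX : 0 < |x| := abs_pos.2 hx0
  have hx2 : x ^ 2 = |x| ^ 2 := (sq_abs x).symm
  have hw0 : 0 < w := by rw [hw]; positivity
  have hwi : 0 < w⁻¹ := inv_pos.2 hw0
  set U := upperRoot w⁻¹ with hU
  have U1 : 1 < U := one_lt_upperRoot hwi
  have hUm : U * (U - 1) = w⁻¹ := upperRoot_mul hwi
  have hS : Real.sqrt (1 + 4 * w⁻¹) = 2 * U - 1 := by rw [hU, upperRoot]; ring
  have hy : curveY x = (1 - x) * (2 * U - 1) := by
    rw [← hS, curveY, ← Real.sqrt_sq hE.le, ← Real.sqrt_mul (by positivity), Real.sqrt_sq hE.le, hw]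
    congr 1
    field_simp
  have a1 : |curveY x + x - 1| = 2 * ((1 - x) * (U - 1)) := by
    rw [hy, show (1 - x) * (2 * U - 1) + x - 1 = 2 * ((1 - x) * (U - 1)) by ring, abs_of_pos]
    have : 0 < U - 1 := by linarith
    positivity
  have a2 : |-curveY x + x - 1| = 2 * ((1 - x) * U) := by
    rw [hy, show -((1 - x) * (2 * U - 1)) + x - 1 = -(2 * ((1 - x) * U)) by ring, abs_neg,
      abs_of_pos]
    have : 0 < U := by linarith
    positivity
  have V0 : 0 < U - 1 := by linarith
  have U0 : 0 < U := by linarith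
  have b1 : U ^ (-l) = (w * (U - 1)) ^ l := by
    rw [Real.rpow_neg U0.le, ← Real.inv_rpow U0.le]
    congr 1
    rw [inv_eq_iff_eq_inv, mul_inv, ← hUm]; field_simp
  have b2 : (U - 1) ^ (-l) = (w * U) ^ l := by
    rw [Real.rpow_neg V0.le, ← Real.inv_rpow V0.le]
    congr 1
    rw [inv_eq_iff_eq_inv, mul_inv, ← hUm]; field_simp
  rw [periodIntegrand, a1, a2, hy, rootDensity, hS, ← hU, b1, b2, abs_of_pos hE,
    Real.mul_rpow zero_le_two (mul_nonneg hE.le V0.le),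
    Real.mul_rpow zero_le_two (mul_nonneg hE.le U0.le),
    Real.mul_rpow hE.le V0.le, Real.mul_rpow hE.le U0.le, Real.mul_rpow hw0.le V0.le,
    Real.mul_rpow hw0.le U0.le, hw, hx2, Real.div_rpow hE.le (by positivity),
    Real.div_rpow hE.le (by positivity), Real.rpow_add hX, Real.rpow_mul hX.le,
    ← Real.rpow_natCast, ← Real.rpow_mul hX.le, ← Real.rpow_mul hX.le, ← Real.rpow_mul hX.le,
    Nat.cast_ofNat, two_mul l, Real.rpow_add hX]
  have p1 : 0 < |x| ^ l := by positivity
  have p2 : 0 < |x| ^ (2 * m) := by positivity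
  have p3 : (0 : ℝ) < 2 ^ l := by positivity
  have p4 : 0 < 2 * U - 1 := by linarith
  field_simp

theorem measurable_rootDensity (l : ℝ) : Measurable (rootDensity l) := by
  unfold rootDensity upperRoot
  fun_prop

/-- Here x = 1/u covers (0, 1); the companion x = 1/(1-u) covers (-∞, 0). In both cases x is the
reciprocal of a root of u(u-1) = w, and w = (1-x)/x². -/
theorem periodIntegrand_inv {l m u : ℝ} (hu : 1 < u) :
    |(-(u ^ 2)⁻¹ : ℝ)| • periodIntegrand l m u⁻¹ =
      (u * (u - 1)) ^ (m - 1) * u ^ (-l) * rootDensity l (u * (u - 1))⁻¹ := by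
  have h0 : 0 < u := by linarith
  have h1 : 0 < u - 1 := by linarith
  rw [periodIntegrand_eq l m (inv_lt_one_of_one_lt₀ hu) (inv_ne_zero h0.ne')
    (w := u * (u - 1)) (by field_simp), abs_neg, abs_of_pos (by positivity),
    abs_of_pos (by positivity), Real.rpow_sub_one (mul_sub_one_pos hu).ne', Real.rpow_neg h0.le,
    Real.inv_rpow h0.le, smul_eq_mul]
  have : 1 - u⁻¹ = (u - 1) / u := by field_simp
  rw [this]
  field_simp

theorem periodIntegrand_neg_inv {l m u : ℝ} (hu : 1 < u) :
    |((u - 1) ^ 2)⁻¹| • periodIntegrand l m (-(u - 1)⁻¹) =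
      (u * (u - 1)) ^ (m - 1) * (u - 1) ^ (-l) * rootDensity l (u * (u - 1))⁻¹ := by
  have h0 : 0 < u := by linarith
  have h1 : 0 < u - 1 := by linarith
  have e : 1 - -(u - 1)⁻¹ = u / (u - 1) := by field_simp; ring
  have h2 : 0 < (u - 1)⁻¹ := by positivity
  rw [periodIntegrand_eq l m (by linarith) (neg_ne_zero.2 h2.ne')
    (w := u * (u - 1)) (by rw [e]; field_simp), e, abs_of_pos (by positivity), abs_neg,
    abs_of_pos h2, Real.rpow_sub_one (mul_sub_one_pos hu).ne', Real.rpow_neg h1.le,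
    Real.inv_rpow h1.le, smul_eq_mul]
  field_simp

theorem image_neg_inv_Ioi_one : (fun u : ℝ => -(u - 1)⁻¹) '' Ioi 1 = Iio 0 := by
  ext x
  simp only [mem_image, mem_Ioi, mem_Iio]
  constructor
  · rintro ⟨u, hu, rfl⟩
    have : 0 < u - 1 := by linarith
    simpa using this
  · intro hx
    refine ⟨1 - x⁻¹, ?_, by simp⟩
    have := inv_lt_zero.2 hx
    linarith

theorem hasDerivAt_neg_inv_sub_one {u : ℝ} (hu : 1 < u) :
    HasDerivAt (fun u : ℝ => -(u - 1)⁻¹) ((u - 1) ^ 2)⁻¹ u := by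
  have h1 : u - 1 ≠ 0 := by linarith
  convert! (((hasDerivAt_id u).sub_const 1).inv h1).neg using 1
  simp [div_eq_mul_inv]

theorem injOn_neg_inv_sub_one : InjOn (fun u : ℝ => -(u - 1)⁻¹) (Ioi 1) := by
  intro u _ v _ h
  simpa using h

theorem Iio_one_ae_eq : (Iio (0 : ℝ) ∪ Ioo 0 1 : Set ℝ) =ᵐ[volume] Iio 1 := by
  have h : (Iic (0 : ℝ) ∪ Ioo 0 1 : Set ℝ) = Iio 1 := Iic_union_Ioo_eq_Iio one_pos
  rw [← h]
  exact Iio_ae_eq_Iic.union (ae_eq_refl _)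

theorem abs_deriv_smul_knotIntegrand {l m u : ℝ} (hu : 1 < u) :
    |(2 * u - 1) / (u * (u - 1))| • (Real.exp (m * Real.log (u * (u - 1))) *
      (rootDensity l (Real.exp (Real.log (u * (u - 1)))) *
        rootDensity l (Real.exp (-Real.log (u * (u - 1)))))) =
    (u * (u - 1)) ^ (m - 1) * u ^ (-l) * rootDensity l (u * (u - 1))⁻¹ +
    (u * (u - 1)) ^ (m - 1) * (u - 1) ^ (-l) * rootDensity l (u * (u - 1))⁻¹ := by
  have h := abs_deriv_mul_logDensity (a := m) (l := l) hu
  rw [logDensity, rootWeight] at h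
  rw [smul_eq_mul, ← mul_assoc, ← mul_assoc, mul_assoc (|_|), h, Real.exp_neg,
    Real.exp_log (mul_sub_one_pos hu)]
  ring

theorem knotIntegral_eq_setIntegral (l m : ℝ) :
    knotIntegral l m = ∫ u in Ioi (1 : ℝ),
      ((u * (u - 1)) ^ (m - 1) * u ^ (-l) * rootDensity l (u * (u - 1))⁻¹ +
        (u * (u - 1)) ^ (m - 1) * (u - 1) ^ (-l) * rootDensity l (u * (u - 1))⁻¹) := by
  rw [knotIntegral, ← setIntegral_univ, ← image_log_mul_Ioi_one,
    integral_image_eq_integral_abs_deriv_smul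
    measurableSet_Ioi (fun u hu => (hasDerivAt_log_mul (mul_sub_one_pos hu).ne').hasDerivWithinAt)
    injOn_log_mul_Ioi_one, setIntegral_congr_fun measurableSet_Ioi
      (fun u hu => abs_deriv_smul_knotIntegrand hu)]

/-- Both terms are nonnegative, so each is dominated by their sum, which is the given integrand in
the coordinate u. -/
theorem integrableOn_root_terms {l m : ℝ} (h : Integrable fun τ : ℝ => Real.exp (m * τ) *
      (rootDensity l (Real.exp τ) * rootDensity l (Real.exp (-τ)))) :
    IntegrableOn (fun u : ℝ =>
      (u * (u - 1)) ^ (m - 1) * u ^ (-l) * rootDensity l (u * (u - 1))⁻¹) (Ioi 1) ∧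
    IntegrableOn (fun u : ℝ =>
      (u * (u - 1)) ^ (m - 1) * (u - 1) ^ (-l) * rootDensity l (u * (u - 1))⁻¹) (Ioi 1) := by
  have hm := measurable_rootDensity l
  rw [← integrableOn_univ, ← image_log_mul_Ioi_one,
    integrableOn_image_iff_integrableOn_abs_deriv_smul
    measurableSet_Ioi (fun u hu => (hasDerivAt_log_mul (mul_sub_one_pos hu).ne').hasDerivWithinAt)
    injOn_log_mul_Ioi_one] at h
  have h' := h.congr_fun (fun u hu => abs_deriv_smul_knotIntegrand hu) measurableSet_Ioi
  have pos : ∀ u ∈ Ioi (1 : ℝ),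
      0 ≤ (u * (u - 1)) ^ (m - 1) * u ^ (-l) * rootDensity l (u * (u - 1))⁻¹ ∧
      0 ≤ (u * (u - 1)) ^ (m - 1) * (u - 1) ^ (-l) * rootDensity l (u * (u - 1))⁻¹ := by
    intro u hu
    have h1 := mul_sub_one_pos hu
    have h2 : 0 < u - 1 := by linarith [mem_Ioi.1 hu]
    have h3 : 0 < u := by linarith
    have h4 := rootDensity_nonneg (l := l) (inv_pos.2 h1)
    exact ⟨by positivity, by positivity⟩
  constructor
  · refine Integrable.mono' h' (by fun_prop)
      ((ae_restrict_iff' measurableSet_Ioi).2 (ae_of_all _ fun u hu => ?_))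
    rw [Real.norm_eq_abs, abs_of_nonneg (pos u hu).1]
    exact le_add_of_nonneg_right (pos u hu).2
  · refine Integrable.mono' h' (by fun_prop)
      ((ae_restrict_iff' measurableSet_Ioi).2 (ae_of_all _ fun u hu => ?_))
    rw [Real.norm_eq_abs, abs_of_nonneg (pos u hu).2]
    exact le_add_of_nonneg_left (pos u hu).1

theorem integrableOn_periodIntegrand {l m : ℝ} (h : Integrable fun τ : ℝ => Real.exp (m * τ) *
      (rootDensity l (Real.exp τ) * rootDensity l (Real.exp (-τ)))) :
    IntegrableOn (periodIntegrand l m) (Iio 0) ∧ IntegrableOn (periodIntegrand l m) (Ioo 0 1) := by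
  obtain ⟨h1, h2⟩ := integrableOn_root_terms h
  constructor
  · rw [← image_neg_inv_Ioi_one, integrableOn_image_iff_integrableOn_abs_deriv_smul
      measurableSet_Ioi (fun u hu => (hasDerivAt_neg_inv_sub_one hu).hasDerivWithinAt)
      injOn_neg_inv_sub_one]
    exact h2.congr_fun (fun u hu => (periodIntegrand_neg_inv hu).symm) measurableSet_Ioi
  · rw [← image_inv_Ioi_one, integrableOn_image_iff_integrableOn_abs_deriv_smul measurableSet_Ioi
      (fun x hx => (hasDerivAt_inv (by linarith [mem_Ioi.1 hx] : x ≠ 0)).hasDerivWithinAt)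
      (inv_injective.injOn)]
    exact h1.congr_fun (fun u hu => (periodIntegrand_inv hu).symm) measurableSet_Ioi

theorem integral_periodIntegrand {l m : ℝ} (h : Integrable fun τ : ℝ => Real.exp (m * τ) *
      (rootDensity l (Real.exp τ) * rootDensity l (Real.exp (-τ)))) :
    IntegrableOn (periodIntegrand l m) (Iio 1) ∧
      ∫ x in Iio (1 : ℝ), periodIntegrand l m x = knotIntegral l m := by
  obtain ⟨i1, i2⟩ := integrableOn_periodIntegrand h
  obtain ⟨h1, h2⟩ := integrableOn_root_terms h
  refine ⟨(i1.union i2).congr_set_ae Iio_one_ae_eq.symm, ?_⟩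
  rw [← setIntegral_congr_set Iio_one_ae_eq, setIntegral_union
    (Set.disjoint_left.2 fun x hx hx' => lt_asymm (mem_Iio.1 hx) hx'.1) measurableSet_Ioo i1 i2,
    ← image_neg_inv_Ioi_one, ← image_inv_Ioi_one, integral_image_eq_integral_abs_deriv_smul
      measurableSet_Ioi (fun u hu => (hasDerivAt_neg_inv_sub_one hu).hasDerivWithinAt)
      injOn_neg_inv_sub_one, integral_image_eq_integral_abs_deriv_smul measurableSet_Ioi
      (fun x hx => (hasDerivAt_inv (by linarith [mem_Ioi.1 hx] : x ≠ 0)).hasDerivWithinAt)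
      (inv_injective.injOn), setIntegral_congr_fun measurableSet_Ioi
      (fun u hu => periodIntegrand_neg_inv hu), setIntegral_congr_fun measurableSet_Ioi
      (fun u hu => periodIntegrand_inv hu), knotIntegral_eq_setIntegral,
    integral_add h1 h2, add_comm]

/-! ### Elliptic integrals and the arithmetic-geometric mean -/

/-- The complete elliptic integral attached to the arithmetic-geometric mean of `a` and `b`. -/
noncomputable def agmIntegral (a b : ℝ) : ℝ :=
  ∫ t : ℝ, (Real.sqrt ((t ^ 2 + a ^ 2) * (t ^ 2 + b ^ 2)))⁻¹

theorem half_sub_div_sq_add {p s : ℝ} (hs : 0 < s) :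
    ((s - p / s) / 2) ^ 2 + p = ((s + p / s) / 2) ^ 2 := by
  field_simp; ring

theorem image_half_sub_div {p : ℝ} (hp : 0 < p) :
    (fun s : ℝ => (s - p / s) / 2) '' Ioi 0 = univ := by
  refine eq_univ_of_forall fun t => ⟨t + Real.sqrt (t ^ 2 + p), ?_, ?_⟩
  · have h : |t| < Real.sqrt (t ^ 2 + p) := by
      rw [← Real.sqrt_sq_eq_abs]; exact Real.sqrt_lt_sqrt (sq_nonneg t) (by linarith)
    have := neg_abs_le t
    rw [mem_Ioi]; linarith
  · have h : |t| < Real.sqrt (t ^ 2 + p) := by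
      rw [← Real.sqrt_sq_eq_abs]; exact Real.sqrt_lt_sqrt (sq_nonneg t) (by linarith)
    have h1 := neg_abs_le t
    have h2 : t + Real.sqrt (t ^ 2 + p) ≠ 0 := by linarith
    have h3 := Real.sq_sqrt (by positivity : 0 ≤ t ^ 2 + p)
    field_simp
    nlinarith

theorem injOn_half_sub_div {p : ℝ} (hp : 0 < p) :
    InjOn (fun s : ℝ => (s - p / s) / 2) (Ioi 0) := by
  intro s hs r hr h
  have hs : 0 < s := hs
  have hr : 0 < r := hr
  simp only at h
  have e1 := half_sub_div_sq_add (p := p) hs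
  rw [h, half_sub_div_sq_add hr] at e1
  have h1 : 0 < p / s := by positivity
  have h2 : 0 < p / r := by positivity
  have := (sq_eq_sq₀ (by linarith : 0 ≤ (r + p / r) / 2) (by linarith)).1 e1
  linarith

/-- For t = (s - p/s)/2 one has √(t² + p) = (s + p/s)/2, hence dt/√(t² + p) = ds/s. -/
theorem integral_half_sub_div {p : ℝ} (hp : 0 < p) (f : ℝ → ℝ) :
    ∫ t : ℝ, f t / Real.sqrt (t ^ 2 + p) = ∫ s in Ioi (0 : ℝ), f ((s - p / s) / 2) / s := by
  have hd : ∀ s ∈ Ioi (0 : ℝ), HasDerivWithinAt (fun s : ℝ => (s - p / s) / 2)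
      ((1 + p / s ^ 2) / 2) (Ioi 0) s := by
    intro s hs
    have h0 : s ≠ 0 := (mem_Ioi.1 hs).ne'
    have := (((hasDerivAt_id s).sub ((hasDerivAt_inv h0).const_mul p)).div_const 2).hasDerivWithinAt
      (s := Ioi 0)
    convert! this using 1
    field_simp; ring
  rw [← setIntegral_univ, ← image_half_sub_div hp,
    integral_image_eq_integral_abs_deriv_smul measurableSet_Ioi hd (injOn_half_sub_div hp)]
  refine setIntegral_congr_fun measurableSet_Ioi fun s hs => ?_
  have hs : 0 < s := hs
  have h1 : 0 < p / s := by positivity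
  simp only [half_sub_div_sq_add hs]
  rw [Real.sqrt_sq (by positivity), abs_of_pos (by positivity), smul_eq_mul]
  field_simp

/-- Gauss's transformation. -/
theorem agmIntegral_eq {a b : ℝ} (ha : 0 < a) (hb : 0 < b) :
    agmIntegral a b = agmIntegral ((a + b) / 2) (Real.sqrt (a * b)) := by
  have hab := mul_pos ha hb
  have h1 : agmIntegral a b =
      2 * ∫ s in Ioi (0 : ℝ), (Real.sqrt ((s ^ 2 + a ^ 2) * (s ^ 2 + b ^ 2)))⁻¹ := by
    rw [← integral_comp_abs (f := fun s : ℝ => (Real.sqrt ((s ^ 2 + a ^ 2) * (s ^ 2 + b ^ 2)))⁻¹)]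
    simp only [sq_abs]
    rfl
  have h2 : agmIntegral ((a + b) / 2) (Real.sqrt (a * b)) =
      ∫ t : ℝ, (Real.sqrt (t ^ 2 + ((a + b) / 2) ^ 2))⁻¹ / Real.sqrt (t ^ 2 + a * b) := by
    rw [agmIntegral]
    congr 1; funext t
    rw [Real.sq_sqrt hab.le, Real.sqrt_mul (by positivity), mul_inv, ← div_eq_mul_inv]
  rw [h1, h2, integral_half_sub_div hab (fun t => (Real.sqrt (t ^ 2 + ((a + b) / 2) ^ 2))⁻¹),
    ← integral_const_mul]
  refine setIntegral_congr_fun measurableSet_Ioi fun s hs => ?_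
  have hs : 0 < s := hs
  -- Under t = (s - ab/s)/2 the two quadratics in s merge into one quadratic in t times a square;
  -- the arithmetic mean appears here, the geometric mean in the measure ds/s.
  have e : (s ^ 2 + a ^ 2) * (s ^ 2 + b ^ 2) =
      (2 * s) ^ 2 * (((s - a * b / s) / 2) ^ 2 + ((a + b) / 2) ^ 2) := by
    field_simp; ring
  simp only [e]
  rw [Real.sqrt_mul (by positivity), Real.sqrt_sq (by positivity)]
  field_simp

theorem integral_inv_sq_add_sq {c : ℝ} (hc : 0 < c) :
    Integrable (fun t : ℝ => (t ^ 2 + c ^ 2)⁻¹) ∧ ∫ t : ℝ, (t ^ 2 + c ^ 2)⁻¹ = Real.pi / c := by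
  have e : (fun t : ℝ => (t ^ 2 + c ^ 2)⁻¹) =
      fun t => (c ^ 2)⁻¹ * (fun x : ℝ => (1 + x ^ 2)⁻¹) (c⁻¹ * t) := by
    funext t
    field_simp
    ring
  rw [e]
  refine ⟨(integrable_inv_one_add_sq.comp_mul_left' (inv_ne_zero hc.ne')).const_mul _, ?_⟩
  rw [integral_const_mul, Measure.integral_comp_mul_left (fun x : ℝ => (1 + x ^ 2)⁻¹),
    integral_univ_inv_one_add_sq, inv_inv, abs_of_pos hc, smul_eq_mul]
  field_simp

theorem integrable_agm {a b : ℝ} (ha : 0 < a) (hb : 0 < b) :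
    Integrable fun t : ℝ => (Real.sqrt ((t ^ 2 + a ^ 2) * (t ^ 2 + b ^ 2)))⁻¹ := by
  have hc : 0 < min a b := lt_min ha hb
  refine Integrable.mono' (integral_inv_sq_add_sq hc).1 (by fun_prop) (ae_of_all _ fun t => ?_)
  rw [Real.norm_eq_abs, abs_of_nonneg (by positivity)]
  refine inv_anti₀ (by positivity) (Real.le_sqrt_of_sq_le ?_)
  rw [sq (_ + _)]
  gcongr
  · exact min_le_left a b
  · exact min_le_right a b

/-- The integrand decreases in a and b; replacing both by c leaves an arctangent integral. -/
theorem agmIntegral_le {a b c : ℝ} (hc : 0 < c) (hca : c ≤ a) (hcb : c ≤ b) :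
    agmIntegral a b ≤ Real.pi / c := by
  rw [← (integral_inv_sq_add_sq hc).2]
  refine integral_mono (integrable_agm (by linarith) (by linarith)) (integral_inv_sq_add_sq hc).1
    fun t => inv_anti₀ (by positivity) (Real.le_sqrt_of_sq_le ?_)
  rw [sq (_ + _)]
  gcongr

theorem le_agmIntegral {a b c : ℝ} (ha : 0 < a) (hb : 0 < b) (hac : a ≤ c) (hbc : b ≤ c) :
    Real.pi / c ≤ agmIntegral a b := by
  have hc : 0 < c := by linarith
  rw [← (integral_inv_sq_add_sq hc).2]
  refine integral_mono (integral_inv_sq_add_sq hc).1 (integrable_agm ha hb)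
    fun t => inv_anti₀ (by positivity) (Real.sqrt_le_iff.2 ⟨by positivity, ?_⟩)
  rw [sq (_ + _)]
  gcongr

theorem image_one_sub_sq : (fun s : ℝ => 1 - s ^ 2) '' Ioi 0 = Iio 1 := by
  ext x
  simp only [mem_image, mem_Ioi, mem_Iio]
  constructor
  · rintro ⟨s, hs, rfl⟩
    have := pow_pos hs 2
    linarith
  · intro hx
    exact ⟨Real.sqrt (1 - x), Real.sqrt_pos.2 (by linarith), by
      rw [Real.sq_sqrt (by linarith)]; ring⟩

/-- After x = 1 - s², the substitution t = (s - 1/s)/2 makes the radicand (4s²)² (t² + 1/16). -/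
theorem two_mul_integral_eq_agmIntegral :
    2 * ∫ x in Iio (1 : ℝ), 1 / Real.sqrt ((1 - x) * (1 - x + 4 * x ^ 2)) =
      agmIntegral 1 (1 / 4) := by
  have h2 : agmIntegral 1 (1 / 4) =
      ∫ t : ℝ, (Real.sqrt (t ^ 2 + (1 / 4) ^ 2))⁻¹ / Real.sqrt (t ^ 2 + 1) := by
    rw [agmIntegral]
    congr 1; funext t
    rw [Real.sqrt_mul (by positivity), mul_inv, mul_comm, one_pow, ← div_eq_mul_inv]
  have hinj : InjOn (fun s : ℝ => 1 - s ^ 2) (Ioi 0) := by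
    intro s hs r hr h
    have : s ^ 2 = r ^ 2 := by simpa using h
    exact (sq_eq_sq₀ (mem_Ioi.1 hs).le (mem_Ioi.1 hr).le).1 this
  have hd : ∀ s ∈ Ioi (0 : ℝ), HasDerivWithinAt (fun s : ℝ => 1 - s ^ 2) (-(2 * s)) (Ioi 0) s := by
    intro s _
    convert! ((hasDerivAt_pow 2 s).const_sub 1).hasDerivWithinAt using 1
    simp
  rw [h2, integral_half_sub_div one_pos (fun t => (Real.sqrt (t ^ 2 + (1 / 4) ^ 2))⁻¹),
    ← image_one_sub_sq, integral_image_eq_integral_abs_deriv_smul measurableSet_Ioi hd hinj,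
    ← integral_const_mul]
  refine setIntegral_congr_fun measurableSet_Ioi fun s hs => ?_
  have hs : 0 < s := hs
  have e : (1 - (1 - s ^ 2)) * (1 - (1 - s ^ 2) + 4 * (1 - s ^ 2) ^ 2) =
      (4 * s ^ 2) ^ 2 * (((s - 1 / s) / 2) ^ 2 + (1 / 4) ^ 2) := by
    field_simp; ring
  simp only [e]
  rw [Real.sqrt_mul (by positivity), Real.sqrt_sq (by positivity), abs_neg,
    abs_of_pos (by positivity), smul_eq_mul]
  field_simp
  norm_num

/-- After four Gauss steps both means lie in an interval of width 2·10⁻¹¹, and the integral lies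
between π divided by its endpoints. -/
theorem agmIntegral_one_quarter_mem : agmIntegral 1 (1 / 4) ∈ Ico (5.60241216 : ℝ) 5.60241217 := by
  have e1 : agmIntegral 1 (1 / 4) = agmIntegral (5 / 8) (1 / 2) := by
    rw [agmIntegral_eq (by norm_num) (by norm_num),
      show (1 * (1 / 4) : ℝ) = (1 / 2) ^ 2 by norm_num, Real.sqrt_sq (by norm_num)]
    norm_num
  have e2 : agmIntegral (5 / 8) (1 / 2) = agmIntegral (9 / 16) (Real.sqrt (5 / 16)) := by
    rw [agmIntegral_eq (by norm_num) (by norm_num)]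
    norm_num
  set b := Real.sqrt (5 / 16) with hb
  have b1 : 0.55901699437 ≤ b := Real.le_sqrt_of_sq_le (by norm_num)
  have b2 : b ≤ 0.55901699438 := Real.sqrt_le_iff.2 ⟨by norm_num, by norm_num⟩
  have e3 := agmIntegral_eq (a := 9 / 16) (b := b) (by norm_num) (by linarith)
  set a := (9 / 16 + b) / 2 with ha
  set c := Real.sqrt (9 / 16 * b) with hc
  have c1 : 0.56075579295 ≤ c := Real.le_sqrt_of_sq_le (by norm_num; linarith)
  have c2 : c ≤ 0.56075579297 := Real.sqrt_le_iff.2 ⟨by norm_num, by norm_num; linarith⟩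
  have a1 : 0.560758497185 ≤ a := by rw [ha]; norm_num; linarith
  have a2 : a ≤ 0.56075849719 := by rw [ha]; norm_num; linarith
  have e4 := agmIntegral_eq (a := a) (b := c) (by linarith) (by linarith)
  set a' := (a + c) / 2 with ha'
  set d := Real.sqrt (a * c) with hd
  have a3 : a' ≤ 0.56075714508 := by rw [ha']; norm_num at a2 c2 ⊢; linarith
  have a4 : 0.56075714506 ≤ a' := by rw [ha']; norm_num at a1 c1 ⊢; linarith
  have d1 : 0.56075714506 ≤ d := by
    refine Real.le_sqrt_of_sq_le ?_
    calc (0.56075714506 : ℝ) ^ 2 ≤ 0.560758497185 * 0.56075579295 := by norm_num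
      _ ≤ a * c := mul_le_mul a1 c1 (by norm_num) (by linarith)
  have d2 : d ≤ 0.56075714508 := by
    refine Real.sqrt_le_iff.2 ⟨by norm_num, ?_⟩
    calc a * c ≤ 0.56075849719 * 0.56075579297 :=
        mul_le_mul a2 c2 (by linarith) (by norm_num)
      _ ≤ _ := by norm_num
  rw [e1, e2, e3, e4]
  have p1 := Real.pi_gt_d20
  have p2 := Real.pi_lt_d20
  constructor
  · refine le_trans ?_ (le_agmIntegral (by linarith) (by linarith) a3 d2)
    rw [le_div_iff₀ (by norm_num)]
    norm_num at p1 ⊢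
    linarith
  · refine lt_of_le_of_lt (agmIntegral_le (by norm_num) a4 d1) ?_
    rw [div_lt_iff₀ (by norm_num)]
    norm_num at p2 ⊢
    linarith

/-! ### The pairing and the reduction of the weights -/

theorem signBit_of_pos {x : ℝ} (hx : 0 < x) : signBit x = 0 := by simp [signBit, hx.le]

theorem signBit_of_neg {x : ℝ} (hx : x < 0) : signBit x = 1 := by simp [signBit, hx]

theorem pairing_comm (x y : ℝ) : pairing x y = pairing y x := by
  rw [pairing, pairing, mul_comm (signBit x), mul_right_comm _ (Real.log |x| : ℂ)]

theorem neg_one_pow_signBit_mul (n : ℕ) {y z : ℝ} (hy : y ≠ 0) (hz : z ≠ 0) :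
    (-1 : ℂ) ^ (n * signBit (y * z)) = (-1) ^ (n * signBit y) * (-1) ^ (n * signBit z) := by
  rcases hy.lt_or_gt with h1 | h1 <;> rcases hz.lt_or_gt with h2 | h2
  · rw [signBit_of_pos (mul_pos_of_neg_of_neg h1 h2), signBit_of_neg h1, signBit_of_neg h2,
      ← pow_add, mul_one, ← two_mul, pow_mul]
    simp
  · simp [signBit_of_neg (mul_neg_of_neg_of_pos h1 h2), signBit_of_neg h1, signBit_of_pos h2]
  · simp [signBit_of_neg (mul_neg_of_pos_of_neg h1 h2), signBit_of_pos h1, signBit_of_neg h2]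
  · simp [signBit_of_pos (mul_pos h1 h2), signBit_of_pos h1, signBit_of_pos h2]

theorem pairing_mul_right (x : ℝ) {y z : ℝ} (hy : y ≠ 0) (hz : z ≠ 0) :
    pairing x (y * z) = pairing x y * pairing x z := by
  rw [pairing, pairing, pairing, neg_one_pow_signBit_mul _ hy hz, abs_mul,
    Real.log_mul (abs_ne_zero.2 hy) (abs_ne_zero.2 hz), Complex.ofReal_add, mul_add, Complex.exp_add]
  ring

theorem pairing_mul_left {x y : ℝ} (z : ℝ) (hx : x ≠ 0) (hy : y ≠ 0) :
    pairing (x * y) z = pairing x z * pairing y z := by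
  rw [pairing_comm, pairing_mul_right z hx hy, pairing_comm z, pairing_comm z]

theorem pairing_ne_zero (x y : ℝ) : pairing x y ≠ 0 :=
  mul_ne_zero (pow_ne_zero _ (by norm_num)) (Complex.exp_ne_zero _)

theorem pairing_inv_right (x : ℝ) {y : ℝ} (hy : y ≠ 0) : pairing x y⁻¹ = (pairing x y)⁻¹ := by
  refine eq_inv_of_mul_eq_one_left ?_
  rw [← pairing_mul_right x (inv_ne_zero hy) hy, inv_mul_cancel₀ hy]
  simp [pairing, signBit]

theorem pairing_inv_left {x : ℝ} (y : ℝ) (hx : x ≠ 0) : pairing x⁻¹ y = (pairing x y)⁻¹ := by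
  rw [pairing_comm, pairing_inv_right y hx, pairing_comm]

theorem conj_pairing (x y : ℝ) : (starRingEnd ℂ) (pairing x y) = (pairing x y)⁻¹ := by
  rw [pairing, map_mul, mul_inv, map_pow, ← Complex.exp_conj, ← Complex.exp_neg, map_neg, map_one,
    ← inv_pow, inv_neg, inv_one]
  simp [map_ofNat]

theorem ddot_ne_zero (a : Angle) : ddot a ≠ 0 := Units.ne_zero _

theorem ddot_angleConj (a : Angle) : ddot (angleConj a) = (ddot a)⁻¹ := by
  simp [ddot, angleConj]

theorem dot_angleConj (a : Angle) : dot (angleConj a) = dot a := rfl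

theorem ddot_add (a b : Angle) : ddot (a + b) = ddot a * ddot b := by
  simp [ddot]

theorem dot_add (a b : Angle) : dot (a + b) = dot a + dot b := rfl

theorem dot_sub (a b : Angle) : dot (a - b) = dot a - dot b := rfl

/-- The substitution u = ä y moves the second components of the angles into a unitary prefactor; the
Jacobian later cancels |ä|. -/
theorem h_integrand_eq (a c : Angle) {α γ : ℝ} (hα : α ≠ 0) (hγ : γ ≠ 0) {y : ℝ} (hy : y ≠ 0)
    (hy1 : ddot a * y - 1 ≠ 0) :
    PsiBar a c α⁻¹ y⁻¹ * pairing γ y * ((|y|⁻¹ : ℝ) : ℂ) =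
      pairing α (ddot c) * (pairing γ (ddot a))⁻¹ * (|ddot a| : ℝ) *
        (fun u : ℝ => pairing (α * γ) u * (pairing α (u - 1))⁻¹ *
          ((|u| ^ (-dot a - dot c) * |u - 1| ^ (dot a - 1) : ℝ) : ℂ)) (ddot a * y) := by
  have hA := ddot_ne_zero a
  have hC := ddot_ne_zero c
  simp only [PsiBar, Psi, map_mul, map_inv₀, conj_pairing, inv_inv, Complex.conj_ofReal,
    ddot_angleConj, dot_angleConj]
  generalize ddot a = A at *
  generalize ddot c = C at *
  obtain ⟨u, hu⟩ : ∃ u, u = A * y := ⟨_, rfl⟩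
  have hu0 : u ≠ 0 := hu ▸ mul_ne_zero hA hy
  have hyu : y = u * A⁻¹ := by rw [hu]; field_simp
  rw [← hu] at hy1
  have e1 : A⁻¹ * y⁻¹ = u⁻¹ := by rw [hu, mul_inv]
  have e2 : 1 - u⁻¹ = (u - 1) * u⁻¹ := by field_simp
  have e3 : |u⁻¹| ^ dot c / |(u - 1) * u⁻¹| ^ (1 - dot a) * |y|⁻¹ =
      |A| * (|u| ^ (-dot a - dot c) * |u - 1| ^ (dot a - 1)) := by
    have p1 : 0 < |u| := abs_pos.2 hu0
    have p2 : 0 < |u - 1| := abs_pos.2 hy1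
    have p3 : 0 < |A| := abs_pos.2 hA
    have p4 : 0 < |u| ^ (1 - dot a) := by positivity
    have p5 : 0 < |u| ^ dot c := by positivity
    have p6 : 0 < |u - 1| ^ (1 - dot a) := by positivity
    rw [hyu, abs_mul, abs_mul, abs_inv, abs_inv, Real.mul_rpow p2.le (by positivity),
      Real.inv_rpow p1.le, Real.inv_rpow p1.le, show -dot a - dot c = (1 - dot a) - dot c - 1 by ring,
      show dot a - 1 = -(1 - dot a) by ring, Real.rpow_neg p2.le, Real.rpow_sub_one p1.ne',
      Real.rpow_sub p1 (1 - dot a) (dot c)]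
    generalize |u| ^ (1 - dot a) = X at *
    generalize |u| ^ dot c = Y at *
    generalize |u - 1| ^ (1 - dot a) = Z at *
    field_simp
  rw [← hu, e1, e2, mul_assoc (_ * _), mul_mul_mul_comm, ← Complex.ofReal_mul, e3,
    pairing_mul_right _ (mul_ne_zero hy1 (inv_ne_zero hu0)) (inv_ne_zero hC),
    pairing_mul_right _ hy1 (inv_ne_zero hu0), pairing_inv_right _ hu0, pairing_inv_right _ hC,
    pairing_inv_left _ hα, pairing_inv_left _ hα, pairing_inv_left _ hα, hyu,
    pairing_mul_right _ hu0 (inv_ne_zero hA), pairing_inv_right _ hA, pairing_mul_left _ hα hγ,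
    inv_inv, inv_inv]
  push_cast
  ring

theorem h_eq (a c : Angle) {α γ : ℝ} (hα : α ≠ 0) (hγ : γ ≠ 0) :
    h a c α γ = pairing α (ddot c) * (pairing γ (ddot a))⁻¹ *
      ∫ u : ℝ, pairing (α * γ) u * (pairing α (u - 1))⁻¹ *
        ((|u| ^ (-dot a - dot c) * |u - 1| ^ (dot a - 1) : ℝ) : ℂ) := by
  have hA := ddot_ne_zero a
  have hae : ∀ᵐ y : ℝ, y ≠ 0 ∧ ddot a * y - 1 ≠ 0 := by
    filter_upwards [(Set.finite_singleton (0 : ℝ)).countable.ae_notMem volume,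
      (Set.finite_singleton (ddot a)⁻¹).countable.ae_notMem volume] with y h1 h2
    refine ⟨h1, fun h => h2 ?_⟩
    exact eq_inv_of_mul_eq_one_right (by linarith)
  rw [h, integral_congr_ae (hae.mono fun y hy => h_integrand_eq a c hα hγ hy.1 hy.2),
    integral_const_mul, Measure.integral_comp_mul_left
      (fun u : ℝ => pairing (α * γ) u * (pairing α (u - 1))⁻¹ *
        ((|u| ^ (-dot a - dot c) * |u - 1| ^ (dot a - 1) : ℝ) : ℂ)), abs_inv, Complex.real_smul]
  have : ((|ddot a| : ℝ) : ℂ) ≠ 0 := by exact_mod_cast abs_ne_zero.2 hA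
  push_cast
  field_simp

/-- The integral over the tetrahedral variable that remains in the weights of `4_1`. -/
noncomputable def reducedWeight (a l t : ℝ) : ℂ :=
  ∫ u : ℝ, (pairing t (u * (u - 1)))⁻¹ * ((|u| ^ (a - l - 1) * |u - 1| ^ (a - 1) : ℝ) : ℂ)

theorem ae_ne_zero_and_ne_one : ∀ᵐ u : ℝ, u ≠ 0 ∧ u - 1 ≠ 0 := by
  filter_upwards [(Set.finite_singleton (0 : ℝ)).countable.ae_notMem volume,
    (Set.finite_singleton (1 : ℝ)).countable.ae_notMem volume] with y h1 h2
  exact ⟨h1, sub_ne_zero.2 h2⟩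

/-- For these arguments αγ = t⁻¹, so the two characters combine into a single one, evaluated at
u(u-1). -/
theorem h_eq_reducedWeight (a c : Angle) {t l : ℝ} (ht : t ≠ 0) (hl : l = 2 * dot a + dot c - 1) :
    h a c t (t * t)⁻¹ = pairing t (ddot a * ddot a * ddot c) * reducedWeight (dot a) l t := by
  have hA := ddot_ne_zero a
  rw [h_eq a c ht (inv_ne_zero (mul_ne_zero ht ht)), pairing_inv_left _ (mul_ne_zero ht ht),
    pairing_mul_left _ ht ht, inv_inv, pairing_mul_right _ (mul_ne_zero hA hA) (ddot_ne_zero c),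
    pairing_mul_right _ hA hA, reducedWeight, mul_comm (pairing t (ddot c))]
  congr 1
  refine integral_congr_ae (ae_ne_zero_and_ne_one.mono fun u hu => ?_)
  simp only
  rw [show t * (t * t)⁻¹ = t⁻¹ by field_simp, pairing_inv_left _ ht,
    pairing_mul_right _ hu.1 hu.2, mul_inv, show -dot a - dot c = dot a - l - 1 by rw [hl]; ring]

/-- Conjugation undoes the inversion of the arguments inside the integral, so the same integral
returns and only the prefactor is inverted. -/
theorem hBar_eq_reducedWeight (a c : Angle) {t l : ℝ} (ht : t ≠ 0)
    (hl : l = 2 * dot a + dot c - 1) :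
    hBar a c t⁻¹ (t * t) = (pairing t (ddot a * ddot a * ddot c))⁻¹ * reducedWeight (dot a) l t := by
  have hA := ddot_ne_zero a
  have hC := ddot_ne_zero c
  rw [hBar, h_eq _ _ (inv_ne_zero ht) (mul_ne_zero ht ht), pairing_inv_left _ ht,
    pairing_mul_left _ ht ht, ddot_angleConj, ddot_angleConj, pairing_inv_right _ hA,
    pairing_inv_right _ hC, inv_inv, map_mul, ← integral_conj, reducedWeight,
    pairing_mul_right _ (mul_ne_zero hA hA) hC, pairing_mul_right _ hA hA]
  congr 1
  · simp only [map_mul, conj_pairing, inv_inv, mul_inv]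
    ring
  refine integral_congr_ae (ae_ne_zero_and_ne_one.mono fun u hu => ?_)
  simp only
  rw [show t⁻¹ * (t * t) = t by field_simp, pairing_inv_left _ ht,
    pairing_mul_right _ hu.1 hu.2, mul_inv, dot_angleConj, dot_angleConj,
    show -dot a - dot c = dot a - l - 1 by rw [hl]; ring, map_mul, map_mul, inv_inv, conj_pairing,
    conj_pairing, Complex.conj_ofReal]

/-! ### Consequences of the angle equations -/

/-- Edge 0 gives 2a₀ + c₀ + 2b₁ + c₁ = 2ϖ; subtract twice a₁ + b₁ + c₁ = ϖ. Holding in the full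
angle group, this matches both the exponents l and the prefactors of the two weights. -/
theorem AngleStructure41.two_nsmul_add_eq (θ : AngleStructure41) :
    2 • θ.angle 0 0 + θ.angle 0 2 = 2 • θ.angle 1 0 + θ.angle 1 2 := by
  have h1 := θ.balanced 0
  have h2 := θ.sum_eq 1
  simp [Fin.sum_univ_succ, edge41] at h1
  rw [← h2] at h1
  rw [← sub_eq_zero] at h1 ⊢
  rw [← h1]
  abel

theorem AngleStructure41.dot_longitude (θ : AngleStructure41) :
    dot θ.longitude = 2 * dot (θ.angle 0 0) + dot (θ.angle 0 2) - 1 := by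
  rw [longitude, dot_sub, dot_add, two_nsmul, dot_add, two_mul]
  rfl

theorem AngleStructure41.dot_longitude' (θ : AngleStructure41) :
    dot θ.longitude = 2 * dot (θ.angle 1 0) + dot (θ.angle 1 2) - 1 := by
  rw [longitude, θ.two_nsmul_add_eq, dot_sub, dot_add, two_nsmul, dot_add, two_mul]
  rfl

theorem AngleStructure41.ddot_eq (θ : AngleStructure41) :
    ddot (θ.angle 0 0) * ddot (θ.angle 0 0) * ddot (θ.angle 0 2) =
      ddot (θ.angle 1 0) * ddot (θ.angle 1 0) * ddot (θ.angle 1 2) := by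
  rw [← ddot_add, ← ddot_add, ← ddot_add, ← ddot_add, ← two_nsmul, ← two_nsmul,
    θ.two_nsmul_add_eq]

theorem stateProduct41_eq (θ : AngleStructure41) {t : ℝ} (ht : t ≠ 0) :
    stateProduct41 θ ![1, t] = reducedWeight (dot (θ.angle 0 0)) (dot θ.longitude) t *
      reducedWeight (dot (θ.angle 1 0)) (dot θ.longitude) t := by
  have e0 : tetWeight (positive41 0) (θ.angle 0 0) (θ.angle 0 2)
      (fun q k => (![1, t] : Fin 2 → ℝ) (edge41 0 q k)) =
      h (θ.angle 0 0) (θ.angle 0 2) t (t * t)⁻¹ := by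
    simp [tetWeight, positive41, edge41, ht]
  have e1 : tetWeight (positive41 1) (θ.angle 1 0) (θ.angle 1 2)
      (fun q k => (![1, t] : Fin 2 → ℝ) (edge41 1 q k)) =
      hBar (θ.angle 1 0) (θ.angle 1 2) t⁻¹ (t * t) := by
    simp [tetWeight, positive41, edge41]
  rw [stateProduct41, Fin.prod_univ_two, e0, e1, h_eq_reducedWeight _ _ ht θ.dot_longitude,
    hBar_eq_reducedWeight _ _ ht θ.dot_longitude', ← θ.ddot_eq]
  have := pairing_ne_zero t (ddot (θ.angle 0 0) * ddot (θ.angle 0 0) * ddot (θ.angle 0 2))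
  rw [mul_mul_mul_comm, mul_inv_cancel₀ this, one_mul]

/-- The real angles of both tetrahedra lie in the strip on which the weights converge. -/
theorem AngleStructure41.dot_angle_mem (θ : AngleStructure41) (j : Fin 2) :
    0 < dot (θ.angle j 0) ∧ dot θ.longitude < dot (θ.angle j 0) ∧
      2 * dot (θ.angle j 0) < 1 + dot θ.longitude := by
  have h := congrArg dot (θ.sum_eq j)
  rw [dot_add, dot_add, show dot varpi = 1 from rfl] at h
  have h0 := θ.pos j 0
  have h1 := θ.pos j 1
  have h2 := θ.pos j 2
  have hl : dot θ.longitude = 2 * dot (θ.angle j 0) + dot (θ.angle j 2) - 1 := by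
    fin_cases j
    · exact θ.dot_longitude
    · exact θ.dot_longitude'
  -- In real parts λ = a - b and 1 + λ = 2a + c, so the last two inequalities are positivity of b
  -- and c.
  exact ⟨h0, by linarith, by linarith⟩

theorem AngleStructure41.dot_meridian (θ : AngleStructure41) :
    dot θ.meridian = dot (θ.angle 0 0) - dot (θ.angle 1 0) := rfl

/-! ### Splitting the weight by the sign of u(u-1) -/

/-- The density in the variable `u` of the pushforward along `u ↦ u (u - 1)`. -/
noncomputable def kernelDensity (a l u : ℝ) : ℝ := |u| ^ (a - l - 1) * |u - 1| ^ (a - 1)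

theorem integrableOn_kernelDensity_Ioi {a l : ℝ} (h0 : 0 < a) (h2 : 2 * a < 1 + l) :
    IntegrableOn (kernelDensity a l) (Ioi 1) := by
  refine (integrableOn_beta_Ioi_real (p := a - l - 1) h0 (by linarith)).congr_fun
    (fun u hu => ?_) measurableSet_Ioi
  have hu : 1 < u := hu
  simp only [kernelDensity]
  rw [abs_of_pos (by linarith), abs_of_pos (by linarith)]

theorem image_one_sub_Ioi_one : (fun u : ℝ => 1 - u) '' Ioi 1 = Iio 0 := by simp

theorem kernelDensity_one_sub {a l u : ℝ} (hu : 1 < u) :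
    kernelDensity a l (1 - u) = u ^ (a - 1) * (u - 1) ^ (a - l - 1) := by
  rw [kernelDensity, show 1 - u - 1 = -u by ring, abs_neg, abs_sub_comm,
    abs_of_pos (by linarith), abs_of_pos (by linarith), mul_comm]

theorem hasDerivWithinAt_one_sub (s : Set ℝ) (u : ℝ) :
    HasDerivWithinAt (fun u : ℝ => 1 - u) (-1) s u :=
  ((hasDerivAt_id u).const_sub 1).hasDerivWithinAt

theorem integrableOn_kernelDensity_Iio {a l : ℝ} (h1 : l < a) (h2 : 2 * a < 1 + l) :
    IntegrableOn (kernelDensity a l) (Iio 0) := by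
  rw [← image_one_sub_Ioi_one, integrableOn_image_iff_integrableOn_abs_deriv_smul
    measurableSet_Ioi (fun u _ => hasDerivWithinAt_one_sub _ u) (sub_right_injective.injOn)]
  refine (integrableOn_beta_Ioi_real (p := a - 1) (q := a - l) (by linarith) (by linarith)).congr_fun
    (fun u hu => ?_) measurableSet_Ioi
  simp [kernelDensity_one_sub hu]

theorem integrableOn_kernelDensity_Ioo {a l : ℝ} (h0 : 0 < a) (h1 : l < a) :
    IntegrableOn (kernelDensity a l) (Ioo 0 1) := by
  have h := ((intervalIntegrable_iff_integrableOn_Ioo_of_le zero_le_one).1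
    (Complex.betaIntegral_convergent (u := (a - l : ℝ)) (v := a) (by simpa using h1)
      (by simpa using h0))).norm
  refine IntegrableOn.congr_fun h (fun u hu => ?_) measurableSet_Ioo
  have e : (1 - u : ℂ) = ((1 - u : ℝ) : ℂ) := by push_cast; rfl
  simp only [norm_mul]
  rw [e, Complex.norm_cpow_eq_rpow_re_of_pos hu.1,
    Complex.norm_cpow_eq_rpow_re_of_pos (by linarith [hu.2]), kernelDensity, abs_sub_comm u,
    abs_of_pos hu.1, abs_of_pos (by linarith [hu.2])]
  simp

/-- The unitary phase in the Fourier variable. -/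
noncomputable def phase (ξ u : ℝ) : ℂ :=
  Complex.exp (-2 * Real.pi * Complex.I * ξ * Real.log (u * (u - 1)))

theorem norm_phase (ξ u : ℝ) : ‖phase ξ u‖ = 1 := by
  rw [phase, show (-2 * Real.pi * Complex.I * ξ * Real.log (u * (u - 1)) : ℂ) =
    ((-2 * Real.pi * ξ * Real.log (u * (u - 1)) : ℝ) : ℂ) * Complex.I by push_cast; ring,
    Complex.norm_exp_ofReal_mul_I]

theorem integrableOn_phase_mul {s : Set ℝ} {g : ℝ → ℝ} (hg : IntegrableOn g s) (ξ : ℝ) :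
    IntegrableOn (fun u => phase ξ u * (g u : ℂ)) s := by
  have hm : Measurable (phase ξ) := by
    unfold phase
    fun_prop
  exact Integrable.bdd_mul (c := 1) (Integrable.ofReal hg) hm.aestronglyMeasurable
    (ae_of_all _ fun u => (norm_phase ξ u).le)

/-- The reflection u ↦ 1 - u preserves u(u-1) and folds (-∞, 0) onto (1, ∞), where the two densities
add up to `rootWeight`. -/
theorem integral_outer_eq_fourier {a l : ℝ} (h0 : 0 < a) (h1 : l < a) (h2 : 2 * a < 1 + l)
    (ξ : ℝ) :
    (∫ u in Iio (0 : ℝ), phase ξ u * (kernelDensity a l u : ℂ)) +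
      ∫ u in Ioi (1 : ℝ), phase ξ u * (kernelDensity a l u : ℂ) =
    𝓕 (fun τ => (logDensity a l τ : ℂ)) ξ := by
  have i1 := integrableOn_phase_mul (integrableOn_kernelDensity_Ioi h0 h2) ξ
  have i2 := integrableOn_phase_mul (integrableOn_kernelDensity_Iio h1 h2) ξ
  have hd : ∀ u ∈ Ioi (1 : ℝ), HasDerivWithinAt (fun u : ℝ => 1 - u) (-1) (Ioi 1) u :=
    fun u _ => hasDerivWithinAt_one_sub _ u
  rw [← image_one_sub_Ioi_one, integrableOn_image_iff_integrableOn_abs_deriv_smul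
    measurableSet_Ioi hd (sub_right_injective.injOn)] at i2
  rw [← image_one_sub_Ioi_one, integral_image_eq_integral_abs_deriv_smul measurableSet_Ioi hd
    (sub_right_injective.injOn), ← integral_add i2 i1, Real.fourier_real_eq_integral_exp_smul]
  have e : ∀ v : ℝ, Complex.exp (↑(-2 * Real.pi * v * ξ) * Complex.I) • (logDensity a l v : ℂ) =
      (fun τ : ℝ => Complex.exp (-2 * Real.pi * Complex.I * ξ * τ)) v * logDensity a l v := by
    intro v
    simp only [smul_eq_mul]
    congr 2
    push_cast; ring
  simp_rw [e]
  rw [integral_mul_logDensity]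
  refine setIntegral_congr_fun measurableSet_Ioi fun u hu => ?_
  have hu : 1 < u := hu
  have p0 : 0 < u := by linarith
  have p1 : 0 < u - 1 := by linarith
  have e1 : phase ξ (1 - u) = phase ξ u := by
    rw [phase, phase, show (1 - u) * (1 - u - 1) = u * (u - 1) by ring]
  have e2 : rootWeight a l u = u ^ (a - 1) * (u - 1) ^ (a - l - 1) + kernelDensity a l u := by
    rw [rootWeight, kernelDensity, abs_of_pos p0, abs_of_pos p1, Real.mul_rpow p0.le p1.le,
      show a - l - 1 = (a - 1) + -l by ring, Real.rpow_add p0, Real.rpow_add p1]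
    ring
  simp only [e1, e2, kernelDensity_one_sub hu, abs_neg, abs_one, one_smul]
  rw [phase]
  push_cast
  ring

theorem mul_sub_one_neg {u : ℝ} (hu : u ∈ Ioo (0 : ℝ) 1) : u * (u - 1) < 0 :=
  mul_neg_of_pos_of_neg hu.1 (by linarith [hu.2])

/-- `Real.log` of a negative number is the logarithm of its absolute value, and u(1-u) ≤ 1/4. This
keeps the inner density away from τ = 0. -/
theorem log_mul_sub_one_le {u : ℝ} (hu : u ∈ Ioo (0 : ℝ) 1) :
    Real.log (u * (u - 1)) ≤ -Real.log 4 := by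
  rw [← Real.log_neg_eq_log, ← Real.log_inv]
  refine Real.log_le_log (by linarith [mul_sub_one_neg hu]) ?_
  nlinarith [sq_nonneg (u - 1 / 2)]

theorem log_mul_sub_one_inj {u v : ℝ} (hu : u ∈ Ioo (0 : ℝ) 1) (hv : v ∈ Ioo (0 : ℝ) 1)
    (huv : u + v ≠ 1) (h : Real.log (u * (u - 1)) = Real.log (v * (v - 1))) : u = v := by
  rw [← Real.log_neg_eq_log, ← Real.log_neg_eq_log (v * (v - 1))] at h
  have h1 := Real.log_injOn_pos (mem_Ioi.2 (by linarith [mul_sub_one_neg hu]))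
    (mem_Ioi.2 (by linarith [mul_sub_one_neg hv])) h
  have h2 : (u - v) * (u + v - 1) = 0 := by linarith
  rcases mul_eq_zero.1 h2 with h3 | h3
  · linarith
  · exact absurd (by linarith) huv

/-- The map u ↦ u(u-1) folds (0, 1) at its critical point 1/2, so the density is the sum of the
pushforwards from the two halves, where the phase is injective. -/
theorem exists_fourier_eq_integral_inner {a l : ℝ} (h0 : 0 < a) (h1 : l < a) :
    ∃ n : ℝ → ℂ, Integrable n ∧ (∀ τ, -Real.log 4 < τ → n τ = 0) ∧
      ∀ ξ : ℝ, 𝓕 n ξ = ∫ u in Ioo (0 : ℝ) 1, phase ξ u * (kernelDensity a l u : ℂ) := by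
  have i := integrableOn_kernelDensity_Ioo h0 h1
  have s1 : Ioo (0 : ℝ) (1 / 2) ⊆ Ioo 0 1 := Ioo_subset_Ioo_right (by norm_num)
  have s2 : Ioo (1 / 2 : ℝ) 1 ⊆ Ioo 0 1 := Ioo_subset_Ioo_left (by norm_num)
  have hd : ∀ u ∈ Ioo (0 : ℝ) 1, HasDerivAt (fun u : ℝ => Real.log (u * (u - 1)))
      ((2 * u - 1) / (u * (u - 1))) u := fun u hu => hasDerivAt_log_mul (mul_sub_one_neg hu).ne
  have hne : ∀ u ∈ Ioo (0 : ℝ) 1, u ≠ 1 / 2 → (2 * u - 1) / (u * (u - 1)) ≠ 0 := by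
    intro u hu hu2
    refine div_ne_zero (fun h => hu2 (by linarith)) (mul_sub_one_neg hu).ne
  obtain ⟨n₁, hn₁, hn₁', hF₁⟩ := exists_fourier_eq_integral_phase measurableSet_Ioo
    (fun u hu => hd u (s1 hu)) (fun u hu => hne u (s1 hu) hu.2.ne)
    (fun u hu v hv => log_mul_sub_one_inj (s1 hu) (s1 hv) (by linarith [hu.2, hv.2]))
    (g := fun u => (kernelDensity a l u : ℂ)) (Integrable.ofReal (i.mono_set s1))
  obtain ⟨n₂, hn₂, hn₂', hF₂⟩ := exists_fourier_eq_integral_phase measurableSet_Ioo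
    (fun u hu => hd u (s2 hu)) (fun u hu => hne u (s2 hu) hu.1.ne')
    (fun u hu v hv => log_mul_sub_one_inj (s2 hu) (s2 hv) (by linarith [hu.1, hv.1]))
    (g := fun u => (kernelDensity a l u : ℂ)) (Integrable.ofReal (i.mono_set s2))
  refine ⟨n₁ + n₂, hn₁.add hn₂, fun τ hτ => ?_, fun ξ => ?_⟩
  · have k1 : n₁ τ = 0 := hn₁' τ fun ⟨u, hu, h⟩ =>
      absurd (log_mul_sub_one_le (s1 hu)) (by simp only at h; linarith)
    have k2 : n₂ τ = 0 := hn₂' τ fun ⟨u, hu, h⟩ =>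
      absurd (log_mul_sub_one_le (s2 hu)) (by simp only at h; linarith)
    simp [k1, k2]
  · have hae : (Ioo (0 : ℝ) (1 / 2) ∪ Ioo (1 / 2) 1 : Set ℝ) =ᵐ[volume] Ioo 0 1 := by
      rw [← Ioc_union_Ioo_eq_Ioo (by norm_num : (0 : ℝ) ≤ 1 / 2) (by norm_num : (1 / 2 : ℝ) < 1)]
      exact Ioo_ae_eq_Ioc.union (ae_eq_refl _)
    have hadd : 𝓕 (n₁ + n₂) ξ = 𝓕 n₁ ξ + 𝓕 n₂ ξ := by
      have := VectorFourier.fourierIntegral_add (e := Real.fourierChar) (L := innerₗ ℝ)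
        Real.continuous_fourierChar (by exact continuous_inner) hn₁ hn₂
      exact congrFun this ξ
    rw [hadd, hF₁, hF₂, ← setIntegral_congr_set hae, setIntegral_union
      (Set.disjoint_left.2 fun x hx hx' => lt_asymm hx.2 hx'.1) measurableSet_Ioo
      (integrableOn_phase_mul (i.mono_set s1) ξ) (integrableOn_phase_mul (i.mono_set s2) ξ)]
    rfl

theorem pairing_inv_of_pos {t : ℝ} (ht : 0 < t) (u : ℝ) :
    (pairing t (u * (u - 1)))⁻¹ = phase (2 * Real.log t) u := by
  rw [pairing, signBit_of_pos ht, zero_mul, pow_zero, one_mul, ← Complex.exp_neg, phase,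
    Real.log_abs, Real.log_abs]
  congr 1
  push_cast; ring

theorem pairing_neg_inv_of_pos {t : ℝ} (ht : 0 < t) (u : ℝ) :
    (pairing (-t) (u * (u - 1)))⁻¹ = (-1) ^ signBit (u * (u - 1)) * phase (2 * Real.log t) u := by
  rw [pairing, signBit_of_neg (neg_lt_zero.2 ht), one_mul, mul_inv, ← Complex.exp_neg, phase,
    Real.log_abs, Real.log_abs, Real.log_neg_eq_log, ← inv_pow, inv_neg, inv_one]
  congr 2
  push_cast; ring

theorem integral_eq_add_add {f : ℝ → ℂ} (h1 : IntegrableOn f (Iio 0)) (h2 : IntegrableOn f (Ioo 0 1))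
    (h3 : IntegrableOn f (Ioi 1)) :
    ∫ u, f u = ((∫ u in Iio (0 : ℝ), f u) + ∫ u in Ioi (1 : ℝ), f u) + ∫ u in Ioo (0 : ℝ) 1, f u := by
  have hae : (Iio (1 : ℝ) ∪ Ioi 1 : Set ℝ) =ᵐ[volume] univ := by
    rw [← Iic_union_Ioi (a := (1 : ℝ))]
    exact Iio_ae_eq_Iic.union (ae_eq_refl _)
  have hdis : Disjoint (Iio (1 : ℝ)) (Ioi 1) :=
    Set.disjoint_left.2 fun x hx hx' => lt_asymm (mem_Iio.1 hx) (mem_Ioi.1 hx')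
  have h12 := (h1.union h2).congr_set_ae Iio_one_ae_eq.symm
  rw [← setIntegral_univ, ← setIntegral_congr_set hae, setIntegral_union
    hdis measurableSet_Ioi h12 h3,
    ← setIntegral_congr_set Iio_one_ae_eq, setIntegral_union
    (Set.disjoint_left.2 fun x hx hx' => lt_asymm (mem_Iio.1 hx) hx'.1) measurableSet_Ioo h1 h2]
  ring

/-- For -t the pairing acquires the sign of u(u-1), which is negative only on (0, 1). -/
theorem reducedWeight_eq {a l : ℝ} (h0 : 0 < a) (h1 : l < a) (h2 : 2 * a < 1 + l) {t : ℝ}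
    (ht : 0 < t) :
    reducedWeight a l t = 𝓕 (fun τ => (logDensity a l τ : ℂ)) (2 * Real.log t) +
      ∫ u in Ioo (0 : ℝ) 1, phase (2 * Real.log t) u * (kernelDensity a l u : ℂ) ∧
    reducedWeight a l (-t) = 𝓕 (fun τ => (logDensity a l τ : ℂ)) (2 * Real.log t) -
      ∫ u in Ioo (0 : ℝ) 1, phase (2 * Real.log t) u * (kernelDensity a l u : ℂ) := by
  have i1 := integrableOn_phase_mul (integrableOn_kernelDensity_Iio h1 h2) (2 * Real.log t)
  have i2 := integrableOn_phase_mul (integrableOn_kernelDensity_Ioo h0 h1) (2 * Real.log t)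
  have i3 := integrableOn_phase_mul (integrableOn_kernelDensity_Ioi h0 h2) (2 * Real.log t)
  rw [← integral_outer_eq_fourier h0 h1 h2]
  constructor
  · rw [← integral_eq_add_add i1 i2 i3, reducedWeight]
    simp_rw [pairing_inv_of_pos ht]
    rfl
  · have c1 : EqOn (fun u => (pairing (-t) (u * (u - 1)))⁻¹ * (kernelDensity a l u : ℂ))
        (fun u => phase (2 * Real.log t) u * (kernelDensity a l u : ℂ)) (Iio 0) := by
      intro u hu
      have hu : u < 0 := hu
      simp only [pairing_neg_inv_of_pos ht, signBit_of_pos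
        (mul_pos_of_neg_of_neg hu (by linarith : u - 1 < 0)), pow_zero, one_mul]
    have c3 : EqOn (fun u => (pairing (-t) (u * (u - 1)))⁻¹ * (kernelDensity a l u : ℂ))
        (fun u => phase (2 * Real.log t) u * (kernelDensity a l u : ℂ)) (Ioi 1) := by
      intro u hu
      simp only [pairing_neg_inv_of_pos ht, signBit_of_pos (mul_sub_one_pos hu), pow_zero, one_mul]
    have c2 : EqOn (fun u => (pairing (-t) (u * (u - 1)))⁻¹ * (kernelDensity a l u : ℂ))
        (fun u => -(phase (2 * Real.log t) u * (kernelDensity a l u : ℂ))) (Ioo 0 1) := by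
      intro u hu
      simp only [pairing_neg_inv_of_pos ht, signBit_of_neg (mul_sub_one_neg hu), pow_one]
      ring
    have := integral_eq_add_add (i1.congr_fun c1.symm measurableSet_Iio)
      (IntegrableOn.congr_fun i2.neg c2.symm measurableSet_Ioo)
      (i3.congr_fun c3.symm measurableSet_Ioi)
    rw [setIntegral_congr_fun measurableSet_Iio c1, setIntegral_congr_fun measurableSet_Ioo c2,
      setIntegral_congr_fun measurableSet_Ioi c3, integral_neg, ← sub_eq_add_neg] at this
    exact this

/-! ### Convergence of the state-integral -/

/-- The integral over an annulus in `ℝˣ` in logarithmic coordinates. -/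
theorem integral_annulus {r R : ℝ} (hr : 0 < r) (hrR : r < R) {f Φ Ψ : ℝ → ℂ} (hΦ : Continuous Φ)
    (hΨ : Continuous Ψ) (hf : ∀ t > 0, f t = Φ (2 * Real.log t) * ((t⁻¹ : ℝ) : ℂ))
    (hf' : ∀ t > 0, f (-t) = Ψ (2 * Real.log t) * ((t⁻¹ : ℝ) : ℂ)) :
    ∫ t in {t : ℝ | r < |t| ∧ |t| < R}, f t =
      ∫ ξ in (2 * Real.log r)..(2 * Real.log R), (Φ ξ + Ψ ξ) / 2 := by
  have hR : 0 < R := hr.trans hrR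
  have hset : {t : ℝ | r < |t| ∧ |t| < R} = Ioo r R ∪ Ioo (-R) (-r) := by
    ext t
    simp only [mem_ofPred_eq, mem_union, mem_Ioo, lt_abs, abs_lt]
    constructor
    · rintro ⟨h | h, h2, h3⟩
      · exact Or.inl ⟨h, h3⟩
      · exact Or.inr ⟨h2, by linarith⟩
    · rintro (⟨h1, h2⟩ | ⟨h1, h2⟩)
      · exact ⟨Or.inl h1, by linarith, h2⟩
      · exact ⟨Or.inr (by linarith), h1, by linarith⟩
  have key : ∀ ξ r : ℝ, 0 < r → (2 * Real.log r < ξ ↔ r < Real.exp (ξ / 2)) := by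
    intro ξ r hr
    rw [← Real.log_lt_iff_lt_exp hr]
    constructor <;> intro h <;> linarith
  have key' : ∀ ξ r : ℝ, 0 < r → (ξ < 2 * Real.log r ↔ Real.exp (ξ / 2) < r) := by
    intro ξ r hr
    rw [← Real.lt_log_iff_exp_lt hr]
    constructor <;> intro h <;> linarith
  have him : (fun ξ : ℝ => Real.exp (ξ / 2)) '' Ioo (2 * Real.log r) (2 * Real.log R) =
      Ioo r R := by
    ext t
    constructor
    · rintro ⟨ξ, hξ, rfl⟩
      exact ⟨(key ξ r hr).1 hξ.1, (key' ξ R hR).1 hξ.2⟩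
    · intro ht
      have h0 : 0 < t := hr.trans ht.1
      have e : Real.exp (2 * Real.log t / 2) = t := by
        rw [mul_div_cancel_left₀ _ two_ne_zero, Real.exp_log h0]
      exact ⟨2 * Real.log t, ⟨(key _ r hr).2 (by rw [e]; exact ht.1),
        (key' _ R hR).2 (by rw [e]; exact ht.2)⟩, e⟩
  have him' : (fun ξ : ℝ => -Real.exp (ξ / 2)) '' Ioo (2 * Real.log r) (2 * Real.log R) =
      Ioo (-R) (-r) := by
    rw [← Set.image_neg_Ioo, ← him, image_image]
  have hd : ∀ ξ : ℝ, HasDerivAt (fun ξ : ℝ => Real.exp (ξ / 2)) (Real.exp (ξ / 2) * (1 / 2)) ξ :=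
    fun ξ => ((hasDerivAt_id ξ).div_const 2).exp
  have hd' : ∀ ξ : ℝ, HasDerivAt (fun ξ : ℝ => -Real.exp (ξ / 2)) (-(Real.exp (ξ / 2) * (1 / 2))) ξ :=
    fun ξ => (hd ξ).neg
  have hinj : Function.Injective fun ξ : ℝ => Real.exp (ξ / 2) := by
    intro x y h
    have := Real.exp_injective h
    linarith
  have hinj' : Function.Injective fun ξ : ℝ => -Real.exp (ξ / 2) := fun x y h =>
    hinj (neg_injective h)
  -- With t = e^(ξ/2) the Haar measure dt/t is dξ/2.
  have v1 : ∀ ξ : ℝ, |Real.exp (ξ / 2) * (1 / 2)| • f (Real.exp (ξ / 2)) = Φ ξ / 2 := by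
    intro ξ
    have h0 := Real.exp_pos (ξ / 2)
    rw [hf _ h0, Real.log_exp, mul_div_cancel₀ _ two_ne_zero, abs_of_pos (by positivity),
      Complex.real_smul]
    have : (Real.exp (ξ / 2) : ℂ) ≠ 0 := by exact_mod_cast h0.ne'
    rw [Complex.ofReal_inv, Complex.ofReal_mul]
    push_cast at this ⊢
    field_simp
  have v2 : ∀ ξ : ℝ, |-(Real.exp (ξ / 2) * (1 / 2))| • f (-Real.exp (ξ / 2)) = Ψ ξ / 2 := by
    intro ξ
    have h0 := Real.exp_pos (ξ / 2)
    rw [hf' _ h0, Real.log_exp, mul_div_cancel₀ _ two_ne_zero, abs_neg, abs_of_pos (by positivity),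
      Complex.real_smul]
    have : (Real.exp (ξ / 2) : ℂ) ≠ 0 := by exact_mod_cast h0.ne'
    rw [Complex.ofReal_inv, Complex.ofReal_mul]
    push_cast at this ⊢
    field_simp
  have hlog : 2 * Real.log r ≤ 2 * Real.log R := by
    have := Real.log_lt_log hr hrR
    linarith
  have iΦ : IntegrableOn (fun ξ => Φ ξ / 2) (Ioo (2 * Real.log r) (2 * Real.log R)) :=
    ((hΦ.div_const 2).integrableOn_Icc).mono_set Ioo_subset_Icc_self
  have iΨ : IntegrableOn (fun ξ => Ψ ξ / 2) (Ioo (2 * Real.log r) (2 * Real.log R)) :=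
    ((hΨ.div_const 2).integrableOn_Icc).mono_set Ioo_subset_Icc_self
  have j1 : IntegrableOn f (Ioo r R) := by
    rw [← him, integrableOn_image_iff_integrableOn_abs_deriv_smul measurableSet_Ioo
      (fun ξ _ => (hd ξ).hasDerivWithinAt) hinj.injOn]
    simpa only [v1] using iΦ
  have j2 : IntegrableOn f (Ioo (-R) (-r)) := by
    rw [← him', integrableOn_image_iff_integrableOn_abs_deriv_smul measurableSet_Ioo
      (fun ξ _ => (hd' ξ).hasDerivWithinAt) hinj'.injOn]
    simpa only [v2] using iΨ
  rw [hset, setIntegral_union (Set.disjoint_left.2 fun x hx hx' => by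
    linarith [hx.1, hx'.2]) measurableSet_Ioo j1 j2, ← him, ← him',
    integral_image_eq_integral_abs_deriv_smul measurableSet_Ioo
      (fun ξ _ => (hd ξ).hasDerivWithinAt) hinj.injOn,
    integral_image_eq_integral_abs_deriv_smul measurableSet_Ioo
      (fun ξ _ => (hd' ξ).hasDerivWithinAt) hinj'.injOn]
  simp only [v1, v2]
  rw [← integral_add iΦ iΨ, intervalIntegral.integral_of_le hlog, integral_Ioc_eq_integral_Ioo]
  simp only [add_div]

theorem hasStateIntegral41 (θ : AngleStructure41) :
    HasStateIntegral41 θ (knotIntegral (dot θ.longitude) (dot θ.meridian)) := by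
  obtain ⟨a0, a1, a2⟩ := θ.dot_angle_mem 0
  obtain ⟨b0, b1, b2⟩ := θ.dot_angle_mem 1
  have hst := fun (t : ℝ) (ht : t ≠ 0) => stateProduct41_eq θ ht
  rw [θ.dot_meridian, HasStateIntegral41]
  unfold truncatedStateIntegral41
  generalize dot θ.longitude = l at *
  generalize dot (θ.angle 0 0) = a at *
  generalize dot (θ.angle 1 0) = b at *
  obtain ⟨n, hn, hn0, hFn⟩ := exists_fourier_eq_integral_inner a0 a1
  obtain ⟨k, hk, hk0, hFk⟩ := exists_fourier_eq_integral_inner b0 b1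
  set P := 𝓕 (fun τ => (logDensity a l τ : ℂ)) with hP
  set Q := 𝓕 (fun τ => (logDensity b l τ : ℂ)) with hQ
  have cP : Continuous P := continuous_fourier_of_integrable (integrable_ofReal_logDensity a0 a1 a2)
  have cQ : Continuous Q := continuous_fourier_of_integrable (integrable_ofReal_logDensity b0 b1 b2)
  have cn : Continuous (𝓕 n) := continuous_fourier_of_integrable hn
  have ck : Continuous (𝓕 k) := continuous_fourier_of_integrable hk
  have iPQ : ∀ x y, IntervalIntegrable (fun ξ => P ξ * Q ξ) volume x y :=
    fun x y => (cP.mul cQ).intervalIntegrable x y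
  have ink : ∀ x y, IntervalIntegrable (fun ξ => 𝓕 n ξ * 𝓕 k ξ) volume x y :=
    fun x y => (cn.mul ck).intervalIntegrable x y
  have htr : ∀ p : ℝ × ℝ, 0 < p.1 → p.1 < p.2 →
      (∫ t in {t : ℝ | p.1 < |t| ∧ |t| < p.2}, stateProduct41 θ ![1, t] * ((|t|⁻¹ : ℝ) : ℂ)) =
      (∫ ξ in (2 * Real.log p.1)..(2 * Real.log p.2), P ξ * Q ξ) +
        ∫ ξ in (2 * Real.log p.1)..(2 * Real.log p.2), 𝓕 n ξ * 𝓕 k ξ := by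
    intro p hp1 hp2
    rw [integral_annulus hp1 hp2 (Φ := fun ξ => (P ξ + 𝓕 n ξ) * (Q ξ + 𝓕 k ξ))
      (Ψ := fun ξ => (P ξ - 𝓕 n ξ) * (Q ξ - 𝓕 k ξ)) ((cP.add cn).mul (cQ.add ck))
      ((cP.sub cn).mul (cQ.sub ck)), ← intervalIntegral.integral_add
      (iPQ _ _) (ink _ _)]
    -- The cross terms PK and NQ cancel between t and -t.
    · congr 1
      funext ξ
      ring
    · intro t ht
      rw [hst t ht.ne', (reducedWeight_eq a0 a1 a2 ht).1, (reducedWeight_eq b0 b1 b2 ht).1,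
        abs_of_pos ht, hFn, hFk]
    · intro t ht
      rw [hst (-t) (neg_ne_zero.2 ht.ne'), (reducedWeight_eq a0 a1 a2 ht).2,
        (reducedWeight_eq b0 b1 b2 ht).2, abs_neg, abs_of_pos ht, hFn, hFk]
  have hbot : Tendsto (fun p : ℝ × ℝ => 2 * Real.log p.1) (𝓝[>] (0 : ℝ) ×ˢ atTop) atBot :=
    (Real.tendsto_log_nhdsGT_zero.comp tendsto_fst).const_mul_atBot two_pos
  have htop : Tendsto (fun p : ℝ × ℝ => 2 * Real.log p.2) (𝓝[>] (0 : ℝ) ×ˢ atTop) atTop :=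
    (Real.tendsto_log_atTop.comp tendsto_snd).const_mul_atTop two_pos
  have t1 := intervalIntegral_tendsto_integral
    (integrable_fourier_logDensity_mul a0 a1 a2 b0 b1 b2) hbot htop
  rw [integral_fourier_logDensity_mul a0 a1 a2 b0 b1 b2] at t1
  -- The product of the inner transforms contributes nothing in the limit, because log 4 > 0.
  have t2 := (tendsto_integral_fourier_mul_fourier (Real.log_pos (by norm_num : (1 : ℝ) < 4))
    hn hk hn0 hk0).comp (hbot.prodMk htop)
  have t3 := t1.add t2
  rw [add_zero] at t3
  -- Parseval yields the exponent b - a, while the meridian is a - b; τ ↦ -τ exchanges the two root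
  -- densities.
  have hsym : knotIntegral l (b - a) = knotIntegral l (a - b) := by
    rw [knotIntegral, ← integral_neg_eq_self, knotIntegral]
    congr 1; funext τ
    rw [neg_neg, mul_comm (rootDensity l (Real.exp (-τ)))]
    congr 2; ring
  rw [hsym] at t3
  refine t3.congr' ?_
  have ev : ∀ᶠ p : ℝ × ℝ in 𝓝[>] (0 : ℝ) ×ˢ atTop, (0 < p.1 ∧ p.1 < 1) ∧ 1 < p.2 :=
    (show ∀ᶠ x in 𝓝[>] (0 : ℝ), 0 < x ∧ x < 1 from Ioo_mem_nhdsGT one_pos).prod_mk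
      (eventually_gt_atTop 1)
  filter_upwards [ev] with p hp
  exact (htr p hp.1.1 (hp.1.2.trans hp.2)).symm

end EdgeInvariant

/-! ### Assembly -/

theorem mainTheorem7 :
    (∃ E : EdgeInvariant.Angle → EdgeInvariant.Angle → ℂ,
      ∀ θ : EdgeInvariant.AngleStructure41, ∀ lam mu : EdgeInvariant.Angle, ∀ l m : ℝ,
        lam = θ.longitude → mu = θ.meridian →
        l = EdgeInvariant.dot lam → m = EdgeInvariant.dot mu →
          EdgeInvariant.HasStateIntegral41 θ (E lam mu) ∧
          (∀ ε ∈ EdgeInvariant.contourStrip l m,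
            EdgeInvariant.VerticalIntegrable (EdgeInvariant.mellinBarnesIntegrand l m) ε ∧
            E lam mu =
              1 / (2 * Real.pi * Complex.I) *
                EdgeInvariant.verticalIntegral (EdgeInvariant.mellinBarnesIntegrand l m) ε) ∧
          MeasureTheory.IntegrableOn (EdgeInvariant.periodIntegrand l m) (Set.Iio 1) ∧
          E lam mu =
            ((∫ x in Set.Iio (1 : ℝ), EdgeInvariant.periodIntegrand l m x : ℝ) : ℂ)) ∧
    (∀ ε : ℝ, 0 < ε → ε < 1 / 2 →
      EdgeInvariant.VerticalIntegrable
        (fun z => Complex.betaIntegral z z ^ 2 / Complex.cos (Real.pi * z) ^ 2) ε ∧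
      1 / (2 * Real.pi * Complex.I) *
        EdgeInvariant.verticalIntegral
          (fun z => Complex.betaIntegral z z ^ 2 / Complex.cos (Real.pi * z) ^ 2) ε =
        ((2 * ∫ x in Set.Iio (1 : ℝ),
          1 / Real.sqrt ((1 - x) * (1 - x + 4 * x ^ 2)) : ℝ) : ℂ)) ∧
    MeasureTheory.IntegrableOn
      (fun x : ℝ => 1 / Real.sqrt ((1 - x) * (1 - x + 4 * x ^ 2))) (Set.Iio 1) ∧
    (2 * ∫ x in Set.Iio (1 : ℝ), 1 / Real.sqrt ((1 - x) * (1 - x + 4 * x ^ 2))) ∈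
      Set.Ico (5.60241216 : ℝ) 5.60241217 := by
  have e1 : (fun z => Complex.betaIntegral z z ^ 2 / Complex.cos (Real.pi * z) ^ 2) =
      EdgeInvariant.mellinBarnesIntegrand 0 0 := by
    funext z
    simp [EdgeInvariant.mellinBarnesIntegrand, sq]
  have e2 : EdgeInvariant.periodIntegrand 0 0 =
      fun x : ℝ => 2 * (1 / Real.sqrt ((1 - x) * (1 - x + 4 * x ^ 2))) := by
    funext x
    simp [EdgeInvariant.periodIntegrand, EdgeInvariant.curveY]
    ring
  -- Any common exponent a = b in (0, 1/2) would serve; m = 1/4 - 1/4 fits the shape b - a of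
  -- `integrable_knotIntegrand`.
  have hper := EdgeInvariant.integral_periodIntegrand (l := 0) (m := 1 / 4 - 1 / 4)
    (EdgeInvariant.integrable_knotIntegrand (a := 1 / 4) (b := 1 / 4) (by norm_num)
      (by norm_num) (by norm_num) (by norm_num) (by norm_num) (by norm_num))
  rw [sub_self, e2] at hper
  refine ⟨⟨fun lam mu =>
    EdgeInvariant.knotIntegral (EdgeInvariant.dot lam) (EdgeInvariant.dot mu), ?_⟩, ?_, ?_, ?_⟩
  · rintro θ _ _ l m rfl rfl rfl rfl
    obtain ⟨a0, a1, a2⟩ := θ.dot_angle_mem 0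
    obtain ⟨b0, b1, b2⟩ := θ.dot_angle_mem 1
    have hp := EdgeInvariant.integral_periodIntegrand
      (EdgeInvariant.integrable_knotIntegrand b0 b1 b2 a0 a1 a2)
    rw [← θ.dot_meridian] at hp
    exact ⟨EdgeInvariant.hasStateIntegral41 θ, fun ε hε =>
      ⟨EdgeInvariant.verticalIntegrable_mellinBarnesIntegrand hε,
      (EdgeInvariant.verticalIntegral_mellinBarnesIntegrand hε).symm⟩, hp.1, by rw [hp.2]⟩
  · intro ε h0 h1
    have hε : ε ∈ EdgeInvariant.contourStrip 0 0 := by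
      refine ⟨h0, ?_, ?_, ?_, ?_, ?_⟩ <;> linarith
    rw [e1, EdgeInvariant.verticalIntegral_mellinBarnesIntegrand hε, ← hper.2,
      MeasureTheory.integral_const_mul]
    exact ⟨EdgeInvariant.verticalIntegrable_mellinBarnesIntegrand hε, rfl⟩
  · have := hper.1.const_mul (1 / 2)
    simpa [MeasureTheory.IntegrableOn] using this
  · rw [EdgeInvariant.two_mul_integral_eq_agmIntegral]
    exact EdgeInvariant.agmIntegral_one_quarter_mem
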